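/- **Markets.** In an exchange market with Leontief utilities there are finitely many goods $j$ and agents $i$. Agent $i$ has an endowment $W_i=(W_{ij})_j$ and utility $U_i(x)=\min\{x_j/A_{ij} : A_{ij}\neq 0\}$, where $W_{ij},A_{ij}\ge 0$ are rational and $A_i\ne 0$. A price vector $p\ge 0$ is an equilibrium price vector if there are bundles $x_i\ge 0$ such that each $x_i$ maximizes $U_i$ over $\{x\ge0 : p\cdot x\le p\cdot W_i\}$, and for each good $j$ we have $\sum_i x_{ij}\le\sum_i W_{ij}$, with equality if $p_j>0$. For a rational $r$, $size(r)$ is the number of bits of its numerator plus that of its denominator. The size of a market is the number of goods, plus the number of agents, plus the sizes of all vectors $W_i,A_i$, each written as a list of pairs (good id, nonzero coefficient). **Polynomial systems.** Let $F$ be the system $f_i(z)=0$ $(i\in[m])$, $L_j\le z_j\le U_j$ $(j\in[n])$, where $z\in\mathbb R^n$, $L_j,U_j\ge 0$ are rational, and each $f_i$ is given as a list $\mathcal M_{f_i}$ of monomials $(\alpha,d_1,\dots,d_n)$, standing for $\alpha z_1^{d_1}\cdots z_n^{d_n}$ with $\alpha$ rational. Let $\deg f_i$ be the maximum of $\sum_j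 d_j$ over its monomials and $$size[F]=m+n+\sum_j\big(size(U_j)+size(L_j)\big)+\sum_i\Big(\deg f_i+\sum_{(\alpha,d)\in\mathcal M_{f_i}}size(\alpha,d)\Big),$$ where $size(\alpha,d)$ is $size(\alpha)$ plus the number of bits of $d_1,\dots,d_n$. Put $H=M_{\max}U_{\max}^{d}+1$, where $M_{\max}=\max_i|\mathcal M_{f_i}|$, $d=\max_i\deg f_i$, $U_{\max}$ is the largest of all $U_j$ and all $|\alpha|$ (empty maxima are $0$). **Relations.** Let $R'(F)$ be the following system of relations between prices, one of which is $p_s$; the price $p_j$ stands for $z_j$ $(j\in[n])$, and all other prices are auxiliary. - Bounds: $p_j=p_{l_j}+L_jp_s$, $\ p_{t_j}=p_j+p_{u_j}$, $\ p_{t_j}=U_jp_s$. - Monomials: if the variables of a monomial, listed with multiplicity in increasing order of index, are $z_{j_1},\dots,z_{j_D}$, then its value is carried by $p_s$ if $D=0$ and by $p_{j_1}$ if $D=1$. If $D\ge2$ it is carried by the last of $D-1$ new prices, which stand for the products of the first $2,3,\dots,D$ factors and are defined by relations $p_a=p_bp_c/p_s$, where $p_b$ is the previous partial product (initially $p_{j_1}$)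 and $p_c$ is the price of the next factor. - Equations: for each $i$, the partial sums of $\max(\alpha,0)\,p_{\rm monomial}$ over the monomials of $f_i$, and those of $\max(-\alpha,0)\,p_{\rm monomial}$, are formed by new prices, starting from $p=0$ and adding one term at a time; the two final sums are then required to be equal. Thus every relation has one of the types (EQ) $p_a=p_b$, (LIN) $p_a=Bp_b+Cp_c+Dp_s$ with rational $B,C,D\ge0$, (QD) $p_a=p_bp_c/p_s$. **The market $\mathcal M$ of $F$.** It has one good for each price in $R'(F)$, further goods described below, and the following agents. (We write $e_g$ for one unit of good $g$, and $W\to A$ for an agent with endowment $W$ and Leontief coefficients $A$.) - A special agent $e_s\to e_s$. - For each (EQ) relation, with a new good $r$: $\ e_b+e_r\to e_a+e_r$ and $e_a+e_r\to e_b+e_r$. - For each (LIN) relation, with a new good $r$: $\ e_a+e_r\to Be_b+Ce_c+De_s+e_r$ and $Be_b+Ce_c+De_s+e_r\to e_a+e_r$. - For each (QD) relation, with new goods $1,\dots,7$ and further new goods internal to the devices: agents $e_1\to e_4$ and $e_6\to e_5$; two converters $(1;2)$ and $(6;7)$; a combiner $(2,7;3)$; a splitter $(3;4,5)$. In addition,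 (EQ) and (LIN) agents as above, again with a new good for each relation, enforce $p_1=p_c$, $p_2=p_s$, $p_4=p_s$, $p_5=p_b+p_s$, $p_7=p_b+p_s$, $p_6=p_a+p_c$, and the relations listed for the devices: - a converter $(g;h)$ has an internal good $k$, agents $He_h\to e_g+e_k$ and $e_k\to e_h$, and the relation $p_k=Hp_h-p_g$; - a combiner $(g,g';h)$ has internal goods $k,k'$, agents $e_k\to e_g+e_{g'}$, $He_h\to e_k+e_{k'}$, $e_{k'}\to e_h$, and the relations $p_h=p_g+p_{g'}$, $p_{k'}=Hp_g+Hp_{g'}-p_k$; - a splitter $(g;h,h')$ has internal goods $k,k'$, agents $e_k\to e_g$, $He_h+He_{h'}\to e_k+e_{k'}$, $e_{k'}\to e_h+e_{h'}$, and the relation $p_{k'}=Hp_h+Hp_{h'}-p_k$. A relation with a minus sign, $X=Y-Z$, is enforced as the two (LIN) relations $t=Y$ and $t=X+Z$ with a new good of price $t$. **Theorem.** For every system $F$, the market $\mathcal M$ constructed from $F$ satisfies: 1. Every equilibrium price vector $p$ of $\mathcal M$ has $p_s>0$, and $p/p_s$ is again an equilibrium price vector. 2. The equilibrium price vectors of $\mathcal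 M$ with $p_s=1$, projected onto $(p_1,\dots,p_n)$, are exactly the solutions of $F$: $$\{(p_1,\dots,p_n) : p\text{ is an equilibrium price vector of }\mathcal M,\ p_s=1\}=\{z\in\mathbb R^n : z\text{ solves }F\}.$$ Moreover $size[\mathcal M]=poly(size[F])$: there is one polynomial $P$ such that $size[\mathcal M]\le P(size[F])$ for all $F$. -/

import Mathlib

namespace LeontiefReduction

/-! ### Exchange markets with Leontief utilities -/

/-- A trader in an exchange market with set of goods `G`: an initial endowment, and the
coefficients `A j` of the Leontief utility `x ↦ min {x j / A j | A j ≠ 0}`. -/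
structure Trader (G : Type) where
  endow : G → NNRat
  want : G → NNRat

/-- An exchange market with goods `G` and agents `I`, all of whom have Leontief utilities
(each agent is interested in at least one good). -/
structure Market (G I : Type) where
  trader : I → Trader G
  want_ne_zero : ∀ i, ∃ j, (trader i).want j ≠ 0

/-- The number of bits of the numerator and the denominator of a rational number. -/
def ratSize (r : ℚ) : ℕ := Nat.size r.num.natAbs + Nat.size r.den

/-- The Leontief utility `x ↦ min {x j / A j | A j ≠ 0}`. -/
noncomputable def Trader.utility {G : Type} (T : Trader G) (x : G → ℝ) : ℝ :=
  ⨅ j : {j : G // T.want j ≠ 0}, x j.1 / (T.want j.1 : ℝ)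

/-- The nonnegative bundles that the trader can afford by selling her endowment at prices `p`. -/
def Trader.budgetSet {G : Type} [Fintype G] (T : Trader G) (p : G → ℝ) : Set (G → ℝ) :=
  {x | (∀ j, 0 ≤ x j) ∧ ∑ j, p j * x j ≤ ∑ j, p j * (T.endow j : ℝ)}

/-- `x` is a utility maximizing affordable bundle at prices `p`. -/
def Trader.IsOptimal {G : Type} [Fintype G] (T : Trader G) (p x : G → ℝ) : Prop :=
  x ∈ T.budgetSet p ∧ ∀ y ∈ T.budgetSet p, T.utility y ≤ T.utility x

/-- `p` is a vector of (market) equilibrium prices: all agents can be given optimal bundles so that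
no good is in deficiency and every good with a positive price is exactly cleared
(goods of price zero may be in surplus). -/
def Market.IsEquilibrium {G I : Type} [Fintype G] [Fintype I] (M : Market G I)
    (p : G → ℝ) : Prop :=
  (∀ j, 0 ≤ p j) ∧ ∃ x : I → G → ℝ,
    (∀ i, (M.trader i).IsOptimal p (x i)) ∧
    ∀ j, ∑ i, x i j ≤ ∑ i, ((M.trader i).endow j : ℝ) ∧
      (0 < p j → ∑ i, x i j = ∑ i, ((M.trader i).endow j : ℝ))

/-- The number of bits of a vector written as a list of pairs (good id, nonzero coefficient). -/
def bundleSize {G : Type} [Fintype G] (v : G → NNRat) : ℕ :=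
  ∑ j, if v j = 0 then 0 else Nat.size (Fintype.card G) + ratSize (v j)

/-- The encoding size of a market: numbers of goods and agents, plus the sizes of the
endowments and of the utility functions of all agents. -/
def Market.size {G I : Type} [Fintype G] [Fintype I] (M : Market G I) : ℕ :=
  Fintype.card G + Fintype.card I +
    ∑ i, (bundleSize (M.trader i).endow + bundleSize (M.trader i).want)

/-! ### Systems of polynomial equations with box constraints -/

/-- A monomial `coeff * z_1 ^ d_1 * ... * z_n ^ d_n`. -/
structure Mono (n : ℕ) where
  coeff : ℚ
  exp : Fin n → ℕ

/-- The total degree of a monomial. -/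
def Mono.degree {n : ℕ} (μ : Mono n) : ℕ := ∑ j, μ.exp j

/-- The value of a monomial at a real point. -/
def Mono.eval {n : ℕ} (μ : Mono n) (z : Fin n → ℝ) : ℝ := (μ.coeff : ℝ) * ∏ j, z j ^ μ.exp j

/-- The size of the tuple `(coeff, d_1, ..., d_n)`. -/
def Mono.size {n : ℕ} (μ : Mono n) : ℕ := ratSize μ.coeff + ∑ j, Nat.size (μ.exp j)

/-- The indices of the variables of a monomial, with multiplicity: each `j` is listed
`d_j` times. -/
def Mono.factors {n : ℕ} (μ : Mono n) : List (Fin n) :=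
  (List.finRange n).flatMap fun j => List.replicate (μ.exp j) j

/-- A system of `m` polynomial equations `f_i(z) = 0` in `n` variables together with the
constraints `L_j ≤ z_j ≤ U_j`; each polynomial is given by its monomials. -/
structure PolySystem where
  n : ℕ
  m : ℕ
  poly : Fin m → List (Mono n)
  L : Fin n → NNRat
  U : Fin n → NNRat

namespace PolySystem

/-- The monomials of the system: an equation and a position in it. -/
abbrev MonoIdx (F : PolySystem) : Type := (i : Fin F.m) × Fin (F.poly i).length

/-- The monomial with a given index. -/
def mono (F : PolySystem) (k : F.MonoIdx) : Mono F.n := (F.poly k.1).get k.2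

/-- The real solutions of the system. -/
def solutions (F : PolySystem) : Set (Fin F.n → ℝ) :=
  {z | (∀ i, ((F.poly i).map fun μ => μ.eval z).sum = 0) ∧
    ∀ j, (F.L j : ℝ) ≤ z j ∧ z j ≤ (F.U j : ℝ)}

/-- The degree of the `i`-th polynomial: the maximal degree of its monomials. -/
def polyDegree (F : PolySystem) (i : Fin F.m) : ℕ :=
  Finset.univ.sup fun k : Fin (F.poly i).length => (F.mono ⟨i, k⟩).degree

/-- The size of the system. -/
def size (F : PolySystem) : ℕ :=
  F.m + F.n + ∑ j, (ratSize (F.U j) + ratSize (F.L j)) +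
    ∑ i, (F.polyDegree i + ((F.poly i).map Mono.size).sum)

/-- The maximal degree `d` of the polynomials. -/
def maxDegree (F : PolySystem) : ℕ := Finset.univ.sup F.polyDegree

/-- The maximal number of monomials of a polynomial. -/
def maxMonos (F : PolySystem) : ℕ := Finset.univ.sup fun i => (F.poly i).length

/-- The maximum `U_max` of the upper bounds and the absolute values of the coefficients. -/
def maxValue (F : PolySystem) : NNRat :=
  max (Finset.univ.sup F.U) (Finset.univ.sup fun k : F.MonoIdx => Rat.nnabs (F.mono k).coeff)

/-- The constant `H = M_max * U_max ^ d + 1`. -/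
def bound (F : PolySystem) : NNRat := (F.maxMonos : NNRat) * F.maxValue ^ F.maxDegree + 1

end PolySystem

/-! ### Relations between prices -/

/-- Scale invariant linear relations between prices: `eq a b` is `p_a = p_b`, and
`lin a B b C c D` is `p_a = B p_b + C p_c + D p_s`, where `s` is a fixed special good. -/
inductive LinRel (V : Type) : Type
  | eq (a b : V)
  | lin (a : V) (B : NNRat) (b : V) (C : NNRat) (c : V) (D : NNRat)

/-- Renaming of the prices in a linear relation. -/
def LinRel.map {V W : Type} (f : V → W) : LinRel V → LinRel W
  | .eq a b => .eq (f a) (f b)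
  | .lin a B b C c D => .lin (f a) B (f b) C (f c) D

/-- The relation `p_a = p_b * p_c / p_s`. -/
structure QuadRel (V : Type) where
  a : V
  b : V
  c : V

/-- A system of relations between prices `p_v`, `v ∈ V`, with a special price `p_s`: linear
relations indexed by `K`, quadratic relations indexed by `Q`. -/
structure RelSystem (V K Q : Type) where
  s : V
  linRel : K → LinRel V
  quadRel : Q → QuadRel V

namespace PolySystem

/-- Products of variables to be formed: a monomial of degree `D ≥ 2` needs `D - 1` products. -/
abbrev ProdIdx (F : PolySystem) : Type := (k : F.MonoIdx) × Fin ((F.mono k).factors.length - 1)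

/-- Partial sums to be formed: a polynomial with `M` monomials has the partial sums
of its first `0, 1, ..., M` terms. -/
abbrev SumIdx (F : PolySystem) : Type := (i : Fin F.m) × Fin ((F.poly i).length + 1)

/-- The variables of the reformulated system: `s` is the price of the special good, `z j` are the
original variables, `lo j`, `up j` the slacks of the bounds, `cap j` is `z j + up j`,
`prod` are the partial products of the monomials, `pos` and `neg` are
the partial sums of the terms with positive, respectively (up to sign) negative coefficient. -/
inductive PriceVar (F : PolySystem) : Type
  | s
  | z (j : Fin F.n)
  | lo (j : Fin F.n)
  | up (j : Fin F.n)
  | cap (j : Fin F.n)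
  | prod (q : F.ProdIdx)
  | pos (k : F.SumIdx)
  | neg (k : F.SumIdx)
  deriving DecidableEq, Fintype

/-- Indices of the linear relations of the reformulated system. -/
inductive LinIdx (F : PolySystem) : Type
  | lower (j : Fin F.n)
  | capSum (j : Fin F.n)
  | capVal (j : Fin F.n)
  | posZero (i : Fin F.m)
  | posStep (k : F.MonoIdx)
  | negZero (i : Fin F.m)
  | negStep (k : F.MonoIdx)
  | balance (i : Fin F.m)
  deriving DecidableEq, Fintype

/-- The variable carrying the product of the first `t + 1` factors of a monomial. -/
def chainVar (F : PolySystem) (k : F.MonoIdx) :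
    (t : ℕ) → t < (F.mono k).factors.length → F.PriceVar
  | 0, h => .z ((F.mono k).factors.get ⟨0, h⟩)
  | t + 1, h => .prod ⟨k, ⟨t, by omega⟩⟩

/-- The variable carrying the product of all factors of a monomial; this is `s` for a constant
monomial and one of the original variables in degree one. -/
def monoVar (F : PolySystem) (k : F.MonoIdx) : F.PriceVar :=
  if h : (F.mono k).factors.length = 0 then .s
  else F.chainVar k ((F.mono k).factors.length - 1) (by omega)

/-- The linear relations of the reformulated system. -/
def linRel (F : PolySystem) : F.LinIdx → LinRel F.PriceVar
  -- `z_j = lo_j + L_j p_s`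
  | .lower j => .lin (.z j) 1 (.lo j) 0 .s (F.L j)
  -- `cap_j = z_j + up_j` and `cap_j = U_j p_s`
  | .capSum j => .lin (.cap j) 1 (.z j) 1 (.up j) 0
  | .capVal j => .lin (.cap j) 0 .s 0 .s (F.U j)
  -- partial sums of the terms with positive coefficients
  | .posZero i => .lin (.pos ⟨i, 0⟩) 0 .s 0 .s 0
  | .posStep k => .lin (.pos ⟨k.1, k.2.succ⟩) 1 (.pos ⟨k.1, k.2.castSucc⟩)
      (Rat.toNNRat (F.mono k).coeff) (F.monoVar k) 0
  -- partial sums of the negatives of the terms with negative coefficients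
  | .negZero i => .lin (.neg ⟨i, 0⟩) 0 .s 0 .s 0
  | .negStep k => .lin (.neg ⟨k.1, k.2.succ⟩) 1 (.neg ⟨k.1, k.2.castSucc⟩)
      (Rat.toNNRat (-(F.mono k).coeff)) (F.monoVar k) 0
  -- the two sums are equal
  | .balance i => .eq (.pos ⟨i, Fin.last _⟩) (.neg ⟨i, Fin.last _⟩)

/-- The quadratic relations of the reformulated system: the next partial product of a monomial is
the previous one times the next factor. -/
def quadRel (F : PolySystem) (q : F.ProdIdx) : QuadRel F.PriceVar where
  a := .prod q
  b := F.chainVar q.1 q.2.1 (by have := q.2.2; omega)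
  c := .z ((F.mono q.1).factors.get ⟨q.2.1 + 1, by have := q.2.2; omega⟩)

/-- The reformulated, scale invariant system of relations. -/
def relSystem (F : PolySystem) : RelSystem F.PriceVar F.LinIdx F.ProdIdx where
  s := .s
  linRel := F.linRel
  quadRel := F.quadRel

end PolySystem

/-! ### Submarkets enforcing the relations -/

section Gadgets

variable {G : Type} [DecidableEq G]

/-- The bundle of `c` units of good `g`. -/
def unit (g : G) (c : NNRat) : G → NNRat := Pi.single g c

/-- The two agents enforcing a linear relation; `r` is an exclusive good. -/
def LinRel.submarket (s r : G) : LinRel G → Fin 2 → Trader G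
  | .eq a b =>
    ![{ endow := unit b 1 + unit r 1, want := unit a 1 + unit r 1 },
      { endow := unit a 1 + unit r 1, want := unit b 1 + unit r 1 }]
  | .lin a B b C c D =>
    ![{ endow := unit a 1 + unit r 1, want := unit b B + unit c C + unit s D + unit r 1 },
      { endow := unit b B + unit c C + unit s D + unit r 1, want := unit a 1 + unit r 1 }]

/-- The agents of a converter: input `g1`, output `g2`, internal good `g3`. -/
def converter (H : NNRat) (g1 g2 g3 : G) : Fin 2 → Trader G :=
  ![{ endow := unit g2 H, want := unit g1 1 + unit g3 1 },
    { endow := unit g3 1, want := unit g2 1 }]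

/-- The agents of a combiner: inputs `g1`, `g2`, output `g3`, internal goods `g4`, `g5`. -/
def combiner (H : NNRat) (g1 g2 g3 g4 g5 : G) : Fin 3 → Trader G :=
  ![{ endow := unit g4 1, want := unit g1 1 + unit g2 1 },
    { endow := unit g3 H, want := unit g4 1 + unit g5 1 },
    { endow := unit g5 1, want := unit g3 1 }]

/-- The agents of a splitter: input `g1`, outputs `g2`, `g3`, internal goods `g4`, `g5`. -/
def splitter (H : NNRat) (g1 g2 g3 g4 g5 : G) : Fin 3 → Trader G :=
  ![{ endow := unit g4 1, want := unit g1 1 },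
    { endow := unit g2 H + unit g3 H, want := unit g4 1 + unit g5 1 },
    { endow := unit g5 1, want := unit g2 1 + unit g3 1 }]

end Gadgets

/-- The goods exclusive to the submarket of a quadratic relation: `g1, ..., g7`, the internal goods
of the devices, and for each device a good `tot` used to split a linear relation
`p_x = H p_y + H p_z - p_w` into `p_tot = H p_y + H p_z` and `p_tot = p_x + p_w`. -/
inductive QuadGood : Type
  | g1 | g2 | g3 | g4 | g5 | g6 | g7
  | conv1 | conv1tot
  | conv2 | conv2tot
  | comb4 | comb5 | combtot
  | spl4 | spl5 | spltot
  deriving DecidableEq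

instance : Fintype QuadGood where
  elems := {.g1, .g2, .g3, .g4, .g5, .g6, .g7, .conv1, .conv1tot, .conv2, .conv2tot,
    .comb4, .comb5, .combtot, .spl4, .spl5, .spltot}
  complete := by intro x; cases x <;> decide

/-- The agents of the first part of the submarket of a quadratic relation. -/
inductive QuadAgent : Type
  | a1 | a2
  | conv1 (i : Fin 2)
  | conv2 (i : Fin 2)
  | comb (i : Fin 3)
  | spl (i : Fin 3)
  deriving DecidableEq, Fintype

/-- The linear relations of the second part of the submarket of a quadratic relation. -/
inductive QuadLin : Type
  | r1 | r2 | r4 | r5 | r6 | r7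
  | conv1val | conv1sum
  | conv2val | conv2sum
  | comb3 | combval | combsum
  | splval | splsum
  deriving DecidableEq

instance : Fintype QuadLin where
  elems := {.r1, .r2, .r4, .r5, .r6, .r7, .conv1val, .conv1sum, .conv2val, .conv2sum,
    .comb3, .combval, .combsum, .splval, .splsum}
  complete := by intro x; cases x <;> decide

/-- The first part of the submarket for `p_a = p_b * p_c / p_s`; `g` names its exclusive goods. -/
def quadAgents {G : Type} [DecidableEq G] (H : NNRat) (g : QuadGood → G) : QuadAgent → Trader G
  | .a1 => { endow := unit (g .g1) 1, want := unit (g .g4) 1 }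
  | .a2 => { endow := unit (g .g6) 1, want := unit (g .g5) 1 }
  | .conv1 i => converter H (g .g1) (g .g2) (g .conv1) i
  | .conv2 i => converter H (g .g6) (g .g7) (g .conv2) i
  | .comb i => combiner H (g .g2) (g .g7) (g .g3) (g .comb4) (g .comb5) i
  | .spl i => splitter H (g .g3) (g .g4) (g .g5) (g .spl4) (g .spl5) i

/-- The linear relations to be enforced in the second part of the submarket for
`p_a = p_b * p_c / p_s`. -/
def quadLin {G : Type} (H : NNRat) (s : G) (ρ : QuadRel G) (g : QuadGood → G) : QuadLin → LinRel G
  | .r1 => .eq (g .g1) ρ.c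
  | .r2 => .eq (g .g2) s
  | .r4 => .eq (g .g4) s
  | .r5 => .lin (g .g5) 1 ρ.b 0 s 1
  | .r6 => .lin (g .g6) 1 ρ.a 1 ρ.c 0
  | .r7 => .lin (g .g7) 1 ρ.b 0 s 1
  -- `p_conv1 = H p_2 - p_1`
  | .conv1val => .lin (g .conv1tot) H (g .g2) 0 s 0
  | .conv1sum => .lin (g .conv1tot) 1 (g .conv1) 1 (g .g1) 0
  -- `p_conv2 = H p_7 - p_6`
  | .conv2val => .lin (g .conv2tot) H (g .g7) 0 s 0
  | .conv2sum => .lin (g .conv2tot) 1 (g .conv2) 1 (g .g6) 0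
  -- `p_3 = p_2 + p_7`, `p_comb5 = H p_2 + H p_7 - p_comb4`
  | .comb3 => .lin (g .g3) 1 (g .g2) 1 (g .g7) 0
  | .combval => .lin (g .combtot) H (g .g2) H (g .g7) 0
  | .combsum => .lin (g .combtot) 1 (g .comb5) 1 (g .comb4) 0
  -- `p_spl5 = H p_4 + H p_5 - p_spl4`
  | .splval => .lin (g .spltot) H (g .g4) H (g .g5) 0
  | .splsum => .lin (g .spltot) 1 (g .spl5) 1 (g .spl4) 0

/-! ### The market of a system of relations -/

/-- The goods of the market of a system of relations: one good for each price variable, the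
exclusive goods of the submarkets of the quadratic relations, and the exclusive goods of the
submarkets of all linear relations (those of the system, and those within the submarkets of
quadratic relations). -/
inductive MarketGood (V K Q : Type) : Type
  | price (v : V)
  | quad (q : Q) (g : QuadGood)
  | excl (k : K)
  | quadExcl (q : Q) (e : QuadLin)
  deriving DecidableEq, Fintype

/-- The agents of the market of a system of relations. -/
inductive MarketAgent (K Q : Type) : Type
  | special
  | quad (q : Q) (a : QuadAgent)
  | lin (k : K) (i : Fin 2)
  | quadLin (q : Q) (e : QuadLin) (i : Fin 2)
  deriving DecidableEq, Fintype

namespace RelSystem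

variable {V K Q : Type} [DecidableEq V] [DecidableEq K] [DecidableEq Q]

/-- The agents: the special agent owns one unit of the special good and wants only this good; the
others form the submarkets of the relations. -/
def trader (R : RelSystem V K Q) (H : NNRat) : MarketAgent K Q → Trader (MarketGood V K Q)
  | .special => { endow := unit (.price R.s) 1, want := unit (.price R.s) 1 }
  | .quad q a => quadAgents H (.quad q) a
  | .lin k i => ((R.linRel k).map .price).submarket (.price R.s) (.excl k) i
  | .quadLin q e i =>
    (quadLin H (.price R.s)
      ⟨.price (R.quadRel q).a, .price (R.quadRel q).b, .price (R.quadRel q).c⟩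
      (.quad q) e).submarket (.price R.s) (.quadExcl q e) i

end RelSystem

theorem unit_ne {G : Type} [DecidableEq G] (g : G) : unit g 1 g ≠ 0 := by
  simp [unit]

theorem unit_add_ne {G : Type} [DecidableEq G] (v : G → NNRat) (g : G) :
    (v + unit g 1) g ≠ 0 := by
  simp [unit]

theorem LinRel.submarket_want {G : Type} [DecidableEq G] (s r : G) (ρ : LinRel G) (i : Fin 2) :
    ∃ j, (ρ.submarket s r i).want j ≠ 0 := by
  refine ⟨r, ?_⟩
  cases ρ <;> fin_cases i <;> exact unit_add_ne _ r

theorem quadAgents_want {G : Type} [DecidableEq G] (H : NNRat) (g : QuadGood → G) (a : QuadAgent) :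
    ∃ j, (quadAgents H g a).want j ≠ 0 := by
  rcases a with _ | _ | i | i | i | i
  · exact ⟨_, unit_ne _⟩
  · exact ⟨_, unit_ne _⟩
  all_goals
    fin_cases i <;> first | exact ⟨_, unit_ne _⟩ | exact ⟨_, unit_add_ne _ _⟩

namespace RelSystem

variable {V K Q : Type} [DecidableEq V] [DecidableEq K] [DecidableEq Q]

/-- The market of a system of relations. -/
def market (R : RelSystem V K Q) (H : NNRat) :
    Market (MarketGood V K Q) (MarketAgent K Q) where
  trader := R.trader H
  want_ne_zero i := by
    rcases i with _ | ⟨q, a⟩ | ⟨k, i⟩ | ⟨q, e, i⟩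
    · exact ⟨_, unit_ne _⟩
    · exact quadAgents_want _ _ _
    · exact LinRel.submarket_want _ _ _ _
    · exact LinRel.submarket_want _ _ _ _

end RelSystem

namespace PolySystem

/-- The goods of the market constructed from a polynomial system. -/
abbrev Good (F : PolySystem) : Type := MarketGood F.PriceVar F.LinIdx F.ProdIdx

/-- The agents of the market constructed from a polynomial system. -/
abbrev Agent (F : PolySystem) : Type := MarketAgent F.LinIdx F.ProdIdx

/-- The Leontief exchange market constructed from a polynomial system. -/
def market (F : PolySystem) : Market F.Good F.Agent := F.relSystem.market F.bound

/-- The special good, whose price is normalized to `1`. -/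
def specialGood (F : PolySystem) : F.Good := .price .s

/-- The good whose price represents the variable `z_j`. -/
def varGood (F : PolySystem) (j : Fin F.n) : F.Good := .price (.z j)

end PolySystem

end LeontiefReduction

/-!
Each Leontief agent buys a multiple of her bundle of coefficients `A`; at prices `p` the multiple is
`p·W / p·A`, and an optimal bundle exists only if `p·A > 0`. Equilibrium therefore means that all
`p·A` are positive and that the resulting net demands are nonpositive, and zero for goods with a
positive price (`Market.isEquilibrium_iff`). This description is invariant under scaling, and the
special agent makes `p_s` positive.

The two agents of a linear relation own together two units of their exclusive good and demand
`x / y + y / x` units of it, where `x` and `y` are the values of the two sides of the relation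
(including the exclusive good). Since `x / y + y / x ≥ 2` with equality only for `x = y`, every
equilibrium satisfies the relation (`LinRel.holds_of_submarket`). Conversely, once the relation
holds these agents just swap their endowments and have no influence on the other goods
(`LinRel.sum_excess_eq_zero`).

Hence the remaining agents of each quadratic relation clear their goods among themselves. The two
converters put `p_c / p_s` units of good `2` and `(p_a + p_c) / (p_b + p_s)` units of good `7` on
the market, and the combiner buys equally many units of both; the equality of the two quotients is
`p_a p_s = p_b p_c` (`quadratic_of_equilibrium`). Conversely, if `p_c ≤ H p_s`, there are
nonnegative prices of the internal goods at which everything clears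
(`sum_excess_quadAgents_eq_zero`). So equilibria correspond to such nonnegative solutions of
the relations (`RelSystem.holds_of_isEquilibrium`, `RelSystem.isEquilibrium_extend`). Those with
`p_s = 1` correspond to solutions of the polynomial system (`PolySystem.mem_solutions_of_holds`,
`PolySystem.holds_value`), because the auxiliary prices are partial products and partial sums; the
bound `p_c ≤ H` follows from `z_j ≤ U_j` (`PolySystem.le_bound_of_prodIdx`).

For the size, the numbers of goods and agents are quadratic in the size `N` of the system, and all
coefficients are sums of at most four numbers of size `O(N ^ 2)`; only `H` can be larger than
`O(N)`.
-/

namespace LeontiefReduction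

/-! ### Equilibria of Leontief markets -/

section Equilibrium

variable {G I : Type}

theorem Trader.utility_nonneg (T : Trader G) {x : G → ℝ} (hx : ∀ j, 0 ≤ x j) :
    0 ≤ T.utility x :=
  Real.iInf_nonneg fun j => div_nonneg (hx j) (NNRat.cast_nonneg _)

theorem Trader.utility_mul_want_le [Finite G] (T : Trader G) {x : G → ℝ} (hx : ∀ j, 0 ≤ x j)
    (j : G) :
    T.utility x * T.want j ≤ x j := by
  by_cases hj : T.want j = 0
  · simpa [hj] using hx j
  · have hpos : (0 : ℝ) < T.want j := by
      exact_mod_cast pos_iff_ne_zero.mpr hj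
    rw [← le_div_iff₀ hpos]
    exact ciInf_le (Set.finite_range _).bddBelow (⟨j, hj⟩ : {j : G // T.want j ≠ 0})

theorem Trader.utility_mul_want (T : Trader G) (hT : ∃ j, T.want j ≠ 0) (t : ℝ) :
    T.utility (fun j => t * T.want j) = t := by
  obtain ⟨j, hj⟩ := hT
  have : Nonempty {j : G // T.want j ≠ 0} := ⟨⟨j, hj⟩⟩
  have h : ∀ j : {j : G // T.want j ≠ 0}, t * (T.want j.1 : ℝ) / (T.want j.1 : ℝ) = t := by
    intro j
    have : (T.want j.1 : ℝ) ≠ 0 := by exact_mod_cast j.2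
    field_simp
  simp [Trader.utility, h]

theorem unit_apply [DecidableEq G] (g : G) (c : NNRat) (j : G) :
    unit g c j = if j = g then c else 0 := by
  simp [unit, Pi.single_apply]

variable [Fintype G] [Fintype I]

/-- The value of the bundle `v` at prices `p`. -/
def cost (p : G → ℝ) (v : G → NNRat) : ℝ := ∑ j, p j * (v j : ℝ)

theorem cost_add (p : G → ℝ) (v w : G → NNRat) : cost p (v + w) = cost p v + cost p w := by
  simp [cost, mul_add, Finset.sum_add_distrib]

theorem cost_unit [DecidableEq G] (p : G → ℝ) (g : G) (c : NNRat) :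
    cost p (unit g c) = p g * c := by
  rw [cost, Finset.sum_eq_single g]
  · simp [unit]
  · intro j _ hj
    simp [unit, hj]
  · simp

theorem cost_smul (t : ℝ) (p : G → ℝ) (v : G → NNRat) : cost (t • p) v = t * cost p v := by
  simp [cost, Finset.mul_sum, mul_assoc]

theorem cost_nonneg {p : G → ℝ} (hp : ∀ j, 0 ≤ p j) (v : G → NNRat) : 0 ≤ cost p v :=
  Finset.sum_nonneg fun j _ => mul_nonneg (hp j) (NNRat.cast_nonneg _)

/-- The utility that a trader attains at prices `p`: her income divided by the price of the bundle
of coefficients (a junk value if the latter is zero). -/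
noncomputable def Trader.level (T : Trader G) (p : G → ℝ) : ℝ := cost p T.endow / cost p T.want

/-- The net demand for good `j` of a trader who buys a multiple of her bundle of coefficients. -/
noncomputable def Trader.excess (T : Trader G) (p : G → ℝ) (j : G) : ℝ :=
  T.level p * T.want j - T.endow j

theorem Trader.level_smul (T : Trader G) {t : ℝ} (ht : t ≠ 0) (p : G → ℝ) :
    T.level (t • p) = T.level p := by
  rw [level, level, cost_smul, cost_smul, mul_div_mul_left _ _ ht]

theorem Trader.mul_want_mem_budgetSet (T : Trader G) {p : G → ℝ} {t : ℝ} (ht : 0 ≤ t)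
    (h : t * cost p T.want ≤ cost p T.endow) :
    (fun j => t * (T.want j : ℝ)) ∈ T.budgetSet p := by
  refine ⟨fun j => mul_nonneg ht (NNRat.cast_nonneg _), le_trans (le_of_eq ?_) h⟩
  simp only [cost, Finset.mul_sum]
  exact Finset.sum_congr rfl fun j _ => by ring

theorem Trader.level_nonneg (T : Trader G) {p : G → ℝ} (hp : ∀ j, 0 ≤ p j) : 0 ≤ T.level p :=
  div_nonneg (cost_nonneg hp _) (cost_nonneg hp _)

/-- A trader can have an optimal bundle only if the goods she wants are not all free, because
otherwise every utility is affordable. -/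
theorem Trader.IsOptimal.cost_want_pos {T : Trader G} (hT : ∃ j, T.want j ≠ 0) {p x : G → ℝ}
    (hp : ∀ j, 0 ≤ p j) (hx : T.IsOptimal p x) : 0 < cost p T.want := by
  refine lt_of_le_of_ne (cost_nonneg hp _) fun h0 => ?_
  have hu := T.utility_nonneg hx.1.1
  have := hx.2 _ (T.mul_want_mem_budgetSet (t := T.utility x + 1) (by linarith)
    (by rw [← h0, mul_zero]; exact cost_nonneg hp _))
  rw [T.utility_mul_want hT] at this
  linarith

theorem Trader.IsOptimal.level_mul_want_le {T : Trader G} (hT : ∃ j, T.want j ≠ 0)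
    {p x : G → ℝ} (hp : ∀ j, 0 ≤ p j) (hx : T.IsOptimal p x) (j : G) :
    T.level p * T.want j ≤ x j := by
  have hpos := hx.cost_want_pos hT hp
  have := hx.2 _ (T.mul_want_mem_budgetSet (T.level_nonneg hp)
    (le_of_eq (div_mul_cancel₀ _ hpos.ne')))
  rw [T.utility_mul_want hT] at this
  exact (mul_le_mul_of_nonneg_right this (NNRat.cast_nonneg _)).trans
    (T.utility_mul_want_le hx.1.1 j)

/-- Goods with a positive price are not bought in excess of the amount needed. -/
theorem Trader.IsOptimal.eq_level_mul_want {T : Trader G} (hT : ∃ j, T.want j ≠ 0)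
    {p x : G → ℝ} (hp : ∀ j, 0 ≤ p j) (hx : T.IsOptimal p x) {j : G} (hj : 0 < p j) :
    x j = T.level p * T.want j := by
  have hpos := hx.cost_want_pos hT hp
  have hle := hx.level_mul_want_le hT hp
  -- Both bundles cost at most the income, and the needed one costs exactly the income.
  have h1 : ∑ j, p j * (T.level p * T.want j) = ∑ j, p j * (T.endow j : ℝ) := by
    have : T.level p * cost p T.want = cost p T.endow := div_mul_cancel₀ _ hpos.ne'
    rw [cost, cost, Finset.mul_sum] at this
    rw [← this]
    exact Finset.sum_congr rfl fun j _ => by ring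
  have h2 : ∀ j ∈ Finset.univ, p j * (T.level p * T.want j) ≤ p j * x j :=
    fun j _ => mul_le_mul_of_nonneg_left (hle j) (hp j)
  have h3 : ∑ j, p j * (T.level p * T.want j) = ∑ j, p j * x j :=
    le_antisymm (Finset.sum_le_sum h2) (h1 ▸ hx.1.2)
  have := (Finset.sum_eq_sum_iff_of_le h2).1 h3 j (Finset.mem_univ j)
  exact (mul_left_cancel₀ hj.ne' this).symm

theorem Trader.isOptimal_level_mul_want (T : Trader G) (hT : ∃ j, T.want j ≠ 0) {p : G → ℝ}
    (hp : ∀ j, 0 ≤ p j) (hpos : 0 < cost p T.want) :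
    T.IsOptimal p fun j => T.level p * T.want j := by
  refine ⟨T.mul_want_mem_budgetSet (T.level_nonneg hp)
    (le_of_eq (div_mul_cancel₀ _ hpos.ne')), fun y hy => ?_⟩
  rw [T.utility_mul_want hT, Trader.level, le_div_iff₀ hpos, cost, Finset.mul_sum]
  refine le_trans (Finset.sum_le_sum fun j _ => ?_) hy.2
  have := mul_le_mul_of_nonneg_left (T.utility_mul_want_le hy.1 j) (hp j)
  linarith

/-- Equilibrium prices are characterized by the bundles that are multiples of the bundles of
coefficients: consumption beyond these is possible only for free goods, and not needed. -/
theorem Market.isEquilibrium_iff (M : Market G I) (p : G → ℝ) :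
    M.IsEquilibrium p ↔ (∀ j, 0 ≤ p j) ∧ (∀ i, 0 < cost p (M.trader i).want) ∧
      ∀ j, ∑ i, (M.trader i).excess p j ≤ 0 ∧
        (0 < p j → ∑ i, (M.trader i).excess p j = 0) := by
  simp only [Trader.excess, Finset.sum_sub_distrib, sub_nonpos, sub_eq_zero]
  constructor
  · rintro ⟨hp, x, hx, hclear⟩
    refine ⟨hp, fun i => (hx i).cost_want_pos (M.want_ne_zero i) hp, fun j => ⟨?_, fun hj => ?_⟩⟩
    · exact (Finset.sum_le_sum fun i _ =>
        (hx i).level_mul_want_le (M.want_ne_zero i) hp j).trans (hclear j).1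
    · rw [← (hclear j).2 hj]
      exact Finset.sum_congr rfl fun i _ =>
        ((hx i).eq_level_mul_want (M.want_ne_zero i) hp hj).symm
  · rintro ⟨hp, hpos, hclear⟩
    exact ⟨hp, fun i j => (M.trader i).level p * (M.trader i).want j,
      fun i => (M.trader i).isOptimal_level_mul_want (M.want_ne_zero i) hp (hpos i), hclear⟩

theorem Market.IsEquilibrium.smul {M : Market G I} {p : G → ℝ} (h : M.IsEquilibrium p) {t : ℝ}
    (ht : 0 < t) : M.IsEquilibrium (t • p) := by
  rw [Market.isEquilibrium_iff] at h ⊢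
  obtain ⟨hp, hpos, hclear⟩ := h
  refine ⟨fun j => mul_nonneg ht.le (hp j), fun i => ?_, fun j => ?_⟩
  · rw [cost_smul]
    exact mul_pos ht (hpos i)
  · simp only [Trader.excess, Trader.level_smul _ ht.ne']
    exact ⟨(hclear j).1, fun hj => (hclear j).2 (pos_of_mul_pos_right hj ht.le)⟩

end Equilibrium

/-! ### Submarkets of linear relations -/

section Linear

variable {G : Type}

/-- The relation holds at prices `p`, where `s` is the special good. -/
def LinRel.Holds (s : G) (p : G → ℝ) : LinRel G → Prop
  | .eq a b => p a = p b
  | .lin a B b C c D => p a = B * p b + C * p c + D * p s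

theorem LinRel.holds_map {V : Type} (f : V → G) (s : V) (p : G → ℝ) (ρ : LinRel V) :
    (ρ.map f).Holds (f s) p ↔ ρ.Holds s (p ∘ f) := by
  cases ρ <;> rfl

variable [DecidableEq G]

/-- The bundle on the left hand side of a linear relation. -/
def LinRel.lhs : LinRel G → G → NNRat
  | .eq a _ => unit a 1
  | .lin a _ _ _ _ _ => unit a 1

/-- The bundle on the right hand side of a linear relation. -/
def LinRel.rhs (s : G) : LinRel G → G → NNRat
  | .eq _ b => unit b 1
  | .lin _ B b C c D => unit b B + unit c C + unit s D

/-- The two agents of a linear relation exchange its two sides, together with the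
exclusive good. -/
theorem LinRel.sum_submarket (s r : G) (ρ : LinRel G) (f : Trader G → ℝ) :
    ∑ i, f (ρ.submarket s r i) =
      f ⟨ρ.lhs + unit r 1, ρ.rhs s + unit r 1⟩ + f ⟨ρ.rhs s + unit r 1, ρ.lhs + unit r 1⟩ := by
  cases ρ
  · rw [Fin.sum_univ_two, add_comm]
    rfl
  · rw [Fin.sum_univ_two]
    rfl

theorem LinRel.forall_submarket (s r : G) (ρ : LinRel G) (P : Trader G → Prop) :
    (∀ i, P (ρ.submarket s r i)) ↔
      P ⟨ρ.lhs + unit r 1, ρ.rhs s + unit r 1⟩ ∧ P ⟨ρ.rhs s + unit r 1, ρ.lhs + unit r 1⟩ := by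
  cases ρ
  · rw [Fin.forall_fin_two, and_comm]
    rfl
  · rw [Fin.forall_fin_two]
    rfl

variable [Fintype G]

theorem LinRel.holds_iff_cost (s : G) (p : G → ℝ) (ρ : LinRel G) :
    ρ.Holds s p ↔ cost p ρ.lhs = cost p (ρ.rhs s) := by
  cases ρ <;> simp [LinRel.Holds, LinRel.lhs, LinRel.rhs, cost_add, cost_unit, mul_comm]

/-- Both agents together demand the exclusive good `r` in the amount `x / y + y / x`, where
`x` and `y` are the values of the two sides including `r`. As they own two units, `x = y`. -/
theorem LinRel.holds_of_submarket {s r : G} {ρ : LinRel G} {p : G → ℝ}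
    (hl : ρ.lhs r = 0) (hr : ρ.rhs s r = 0)
    (hpos : ∀ i, 0 < cost p (ρ.submarket s r i).want)
    (hex : ∑ i, (ρ.submarket s r i).excess p r ≤ 0) : ρ.Holds s p := by
  rw [LinRel.forall_submarket s r ρ fun T => 0 < cost p T.want] at hpos
  rw [LinRel.sum_submarket s r ρ fun T => T.excess p r] at hex
  obtain ⟨hy, hx⟩ := hpos
  simp only [Trader.excess, Trader.level, Pi.add_apply, hl, hr, unit, Pi.single_eq_same,
    zero_add, NNRat.cast_one, mul_one] at hex
  change 0 < cost p (ρ.rhs s + unit r 1) at hy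
  change 0 < cost p (ρ.lhs + unit r 1) at hx
  change cost p (ρ.lhs + unit r 1) / cost p (ρ.rhs s + unit r 1) - 1 +
    (cost p (ρ.rhs s + unit r 1) / cost p (ρ.lhs + unit r 1) - 1) ≤ 0 at hex
  rw [LinRel.holds_iff_cost]
  suffices cost p (ρ.lhs + unit r 1) = cost p (ρ.rhs s + unit r 1) by
    simpa [cost_add] using this
  generalize cost p (ρ.lhs + unit r 1) = x at *
  generalize cost p (ρ.rhs s + unit r 1) = y at *
  have h : x / y - 1 + (y / x - 1) = (x - y) ^ 2 / (x * y) := by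
    field_simp
    ring
  rw [h, div_le_iff₀ (mul_pos hx hy), zero_mul] at hex
  exact sub_eq_zero.mp (pow_eq_zero_iff two_ne_zero |>.mp (le_antisymm hex (sq_nonneg _)))

/-- If the relation holds, the two agents swap their endowments. -/
theorem LinRel.sum_excess_eq_zero {s r : G} {ρ : LinRel G} {p : G → ℝ}
    (hpos : ∀ i, 0 < cost p (ρ.submarket s r i).want) (h : ρ.Holds s p) (j : G) :
    ∑ i, (ρ.submarket s r i).excess p j = 0 := by
  rw [LinRel.forall_submarket s r ρ fun T => 0 < cost p T.want] at hpos
  rw [LinRel.sum_submarket s r ρ fun T => T.excess p j]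
  rw [LinRel.holds_iff_cost] at h
  have hxy : cost p (ρ.lhs + unit r 1) = cost p (ρ.rhs s + unit r 1) := by
    rw [cost_add, cost_add, h]
  have h1 := hpos.1.ne'
  simp only at h1
  simp only [Trader.excess, Trader.level, hxy, div_self h1]
  ring

/-- The agents of a linear relation neither own nor want the goods outside the relation. -/
theorem LinRel.sum_excess_eq_zero_of_not_mem {s r : G} {ρ : LinRel G} {p : G → ℝ} {j : G}
    (hl : ρ.lhs j = 0) (hr : ρ.rhs s j = 0) (hj : j ≠ r) :
    ∑ i, (ρ.submarket s r i).excess p j = 0 := by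
  rw [LinRel.sum_submarket s r ρ fun T => T.excess p j]
  simp [Trader.excess, hl, hr, unit, hj]

theorem LinRel.cost_want_pos {s r : G} (ρ : LinRel G) {p : G → ℝ} (hp : ∀ j, 0 ≤ p j)
    (hr : 0 < p r) (i : Fin 2) : 0 < cost p (ρ.submarket s r i).want := by
  revert i
  rw [LinRel.forall_submarket s r ρ fun T => 0 < cost p T.want]
  have h : ∀ v : G → NNRat, 0 < cost p (v + unit r 1) := fun v => by
    rw [cost_add, cost_unit]
    simpa using add_pos_of_nonneg_of_pos (cost_nonneg hp v) hr
  exact ⟨h _, h _⟩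

end Linear

/-! ### Submarkets of quadratic relations -/

section Quadratic

variable {G : Type}

/-- The prices of the goods `QuadGood` of the relation `p_a = p_b p_c / p_s` at an equilibrium
with `p_s = 1`, `p_b = b` and `p_c = c`. The prices of `comb4` and `spl4` make the combiner and the
splitter process `c` units; all other prices are given by the linear relations. -/
def quadPrice (H b c : ℝ) : QuadGood → ℝ
  | .g1 => c
  | .g2 | .g4 => 1
  | .g3 => b + 2
  | .g5 | .g7 => b + 1
  | .g6 => b * c + c
  | .conv1 => H - c
  | .conv1tot => H
  | .conv2 => (b + 1) * (H - c)
  | .conv2tot => (b + 1) * H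
  | .comb4 | .spl4 => (b + 2) * c
  | .comb5 | .spl5 => (b + 2) * (H - c)
  | .combtot | .spltot => (b + 2) * H

theorem quadPrice_nonneg {H b c : ℝ} (hb : 0 ≤ b) (hc : 0 ≤ c) (hcH : c ≤ H) (x : QuadGood) :
    0 ≤ quadPrice H b c x := by
  have := sub_nonneg.mpr hcH
  have := hc.trans hcH
  cases x <;> simp only [quadPrice] <;> positivity

theorem quadLin_holds_of_quadPrice {H : NNRat} {s : G} {ρ : QuadRel G} {g : QuadGood → G}
    {p : G → ℝ} (hs : p s = 1) (ha : p ρ.a = p ρ.b * p ρ.c)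
    (hp : ∀ x, p (g x) = quadPrice H (p ρ.b) (p ρ.c) x) (e : QuadLin) :
    (quadLin H s ρ g e).Holds s p := by
  cases e <;> simp [quadLin, LinRel.Holds, hp, hs, ha, quadPrice] <;> ring

variable [DecidableEq G] [Fintype G]

theorem QuadAgent.sum_eq (f : QuadAgent → ℝ) :
    ∑ a, f a = f .a1 + f .a2 + (f (.conv1 0) + f (.conv1 1)) + (f (.conv2 0) + f (.conv2 1)) +
      (f (.comb 0) + f (.comb 1) + f (.comb 2)) + (f (.spl 0) + f (.spl 1) + f (.spl 2)) := by
  have : (Finset.univ : Finset QuadAgent) = {.a1, .a2, .conv1 0, .conv1 1, .conv2 0, .conv2 1,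
      .comb 0, .comb 1, .comb 2, .spl 0, .spl 1, .spl 2} := by decide
  rw [this]
  repeat rw [Finset.sum_insert (by decide)]
  rw [Finset.sum_singleton]
  ring

theorem sum_excess_quadAgents_of_not_mem (H : NNRat) (g : QuadGood → G) (p : G → ℝ) {j : G}
    (hj : ∀ x, j ≠ g x) : ∑ a, (quadAgents H g a).excess p j = 0 := by
  rw [QuadAgent.sum_eq]
  simp [quadAgents, converter, combiner, splitter, Trader.excess, unit, hj]

/-- The balances of the goods `2` and `7`. The converters provide `p_1 / p_2` units of good `2` and
`p_6 / p_7` units of good `7`, and the combiner takes the same number of units of both. -/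
theorem div_eq_div_of_sum_excess_eq_zero {H : NNRat} {g : QuadGood → G}
    (hg : Function.Injective g) {p : G → ℝ} (h2 : 0 < p (g .g2)) (h7 : 0 < p (g .g7))
    (hc1 : p (g .conv1) + p (g .g1) = H * p (g .g2))
    (hc2 : p (g .conv2) + p (g .g6) = H * p (g .g7))
    (he2 : ∑ a, (quadAgents H g a).excess p (g .g2) = 0)
    (he7 : ∑ a, (quadAgents H g a).excess p (g .g7) = 0) :
    p (g .g1) / p (g .g2) = p (g .g6) / p (g .g7) := by
  rw [QuadAgent.sum_eq] at he2 he7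
  simp [quadAgents, converter, combiner, splitter, Trader.excess, Trader.level, cost_add,
    cost_unit, unit_apply, hg.eq_iff] at he2 he7
  rw [eq_sub_of_add_eq hc1, sub_div, mul_div_cancel_right₀ _ h2.ne'] at he2
  rw [eq_sub_of_add_eq hc2, sub_div, mul_div_cancel_right₀ _ h7.ne'] at he7
  linarith

/-- At equilibrium the linear relations and the submarket of a quadratic relation give
`p_c / p_s = (p_a + p_c) / (p_b + p_s)`, that is, `p_a p_s = p_b p_c`. -/
theorem quadratic_of_equilibrium {H : NNRat} {s : G} {ρ : QuadRel G} {g : QuadGood → G}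
    (hg : Function.Injective g) {p : G → ℝ} (hs : 0 < p s) (hb : 0 ≤ p ρ.b)
    (hlin : ∀ e, (quadLin H s ρ g e).Holds s p)
    (hex : ∀ x, 0 < p (g x) → ∑ a, (quadAgents H g a).excess p (g x) = 0) :
    p ρ.a * p s = p ρ.b * p ρ.c := by
  have h1 : p (g .g1) = p ρ.c := hlin .r1
  have h2 : p (g .g2) = p s := hlin .r2
  have h6 := hlin .r6
  have h7 := hlin .r7
  have hc1v := hlin .conv1val
  have hc1s := hlin .conv1sum
  have hc2v := hlin .conv2val
  have hc2s := hlin .conv2sum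
  simp only [quadLin, LinRel.Holds, NNRat.cast_one, NNRat.cast_zero, one_mul, zero_mul,
    add_zero] at h6 h7 hc1v hc1s hc2v hc2s
  have h2pos : 0 < p (g .g2) := h2 ▸ hs
  have h7pos : 0 < p (g .g7) := by linarith
  have h := div_eq_div_of_sum_excess_eq_zero hg h2pos h7pos (by linarith) (by linarith)
    (hex _ h2pos) (hex _ h7pos)
  rw [div_eq_div_iff h2pos.ne' h7pos.ne', h1, h2, h6, h7] at h
  linarith

/-- The multiples of their bundles of coefficients that the agents buy at the prices
`quadPrice`. -/
def quadLevel (H c : ℝ) : QuadAgent → ℝ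
  | .a1 | .a2 => c
  | .conv1 i => ![1, H - c] i
  | .conv2 i => ![1, H - c] i
  | .comb i => ![c, 1, H - c] i
  | .spl i => ![c, 1, H - c] i

theorem cost_quadAgents_want_pos {H : NNRat} (hH : 0 < H) {g : QuadGood → G} {p : G → ℝ}
    {b c : ℝ} (hb : 0 ≤ b) (hp : ∀ x, p (g x) = quadPrice H b c x) (a : QuadAgent) :
    0 < cost p (quadAgents H g a).want := by
  have hH' : (0 : ℝ) < H := by exact_mod_cast hH
  have h1 : 0 < (b + 1) * (H : ℝ) := by positivity
  have h2 : 0 < (b + 2) * (H : ℝ) := by positivity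
  rcases a with _ | _ | i | i | i | i
  rotate_left 2
  all_goals
    try fin_cases i
  all_goals
    simp [quadAgents, converter, combiner, splitter, cost_unit, cost_add, hp, quadPrice]
    try first | exact hH | linarith

theorem level_quadAgents {H : NNRat} (hH : 0 < H) {g : QuadGood → G} {p : G → ℝ}
    {b c : ℝ} (hb : 0 ≤ b) (hp : ∀ x, p (g x) = quadPrice H b c x) (a : QuadAgent) :
    (quadAgents H g a).level p = quadLevel H c a := by
  rw [Trader.level, div_eq_iff (cost_quadAgents_want_pos hH hb hp a).ne']
  rcases a with _ | _ | i | i | i | i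
  rotate_left 2
  all_goals
    try fin_cases i
  all_goals
    simp [quadAgents, converter, combiner, splitter, cost_unit, cost_add, hp, quadPrice, quadLevel]
    try ring

theorem sum_excess_quadAgents_eq_zero {H : NNRat} (hH : 0 < H) {g : QuadGood → G}
    (hg : Function.Injective g) {p : G → ℝ} {b c : ℝ} (hb : 0 ≤ b)
    (hp : ∀ x, p (g x) = quadPrice H b c x) (j : G) :
    ∑ a, (quadAgents H g a).excess p j = 0 := by
  by_cases hj : ∃ x, j = g x
  · obtain ⟨x, rfl⟩ := hj
    simp only [Trader.excess, level_quadAgents hH hb hp]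
    rw [QuadAgent.sum_eq]
    cases x <;>
      simp [quadAgents, converter, combiner, splitter, unit_apply, hg.eq_iff, quadLevel] <;> ring
  · exact sum_excess_quadAgents_of_not_mem H g p (not_exists.mp hj)

end Quadratic

/-! ### Markets of systems of relations -/

section RelSystem

variable {V K Q : Type}

/-- The agents of the market of a system of relations as a disjoint union. -/
def MarketAgent.equivSum (K Q : Type) :
    MarketAgent K Q ≃ Unit ⊕ (Q × QuadAgent) ⊕ (K × Fin 2) ⊕ (Q × QuadLin × Fin 2) where
  toFun
    | .special => .inl ()
    | .quad q a => .inr (.inl (q, a))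
    | .lin k i => .inr (.inr (.inl (k, i)))
    | .quadLin q e i => .inr (.inr (.inr (q, e, i)))
  invFun
    | .inl _ => .special
    | .inr (.inl (q, a)) => .quad q a
    | .inr (.inr (.inl (k, i))) => .lin k i
    | .inr (.inr (.inr (q, e, i))) => .quadLin q e i
  left_inv x := by cases x <;> rfl
  right_inv x := by rcases x with _ | _ | _ | _ <;> rfl

theorem MarketAgent.sum_eq [Fintype K] [Fintype Q] (f : MarketAgent K Q → ℝ) :
    ∑ x, f x = f .special + (∑ q, ∑ a, f (.quad q a) +
      (∑ k, ∑ i, f (.lin k i) + ∑ q, ∑ e, ∑ i, f (.quadLin q e i))) := by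
  rw [← (MarketAgent.equivSum K Q).symm.sum_comp]
  simp [Fintype.sum_sum_type, Fintype.sum_prod_type, MarketAgent.equivSum]

variable [DecidableEq V] [DecidableEq K] [DecidableEq Q]

namespace RelSystem

variable (R : RelSystem V K Q) (H : NNRat)

/-- The linear relation with index `k`, as a relation between prices of goods. -/
def goodRel (k : K) : LinRel (MarketGood V K Q) := (R.linRel k).map .price

/-- The quadratic relation with index `q`, as a relation between prices of goods. -/
def goodQuadRel (q : Q) : QuadRel (MarketGood V K Q) :=
  ⟨.price (R.quadRel q).a, .price (R.quadRel q).b, .price (R.quadRel q).c⟩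

/-- The linear relation with index `e` in the submarket of the quadratic relation with
index `q`. -/
def goodQuadLin (q : Q) (e : QuadLin) : LinRel (MarketGood V K Q) :=
  LeontiefReduction.quadLin H (.price R.s) (R.goodQuadRel q) (.quad q) e

theorem trader_lin (k : K) (i : Fin 2) : R.trader H (.lin k i) =
    (R.goodRel k).submarket (.price R.s) (.excl k) i := rfl

theorem trader_quadLin (q : Q) (e : QuadLin) (i : Fin 2) : R.trader H (.quadLin q e i) =
    (R.goodQuadLin H q e).submarket (.price R.s) (.quadExcl q e) i := rfl

theorem trader_quad (q : Q) (a : QuadAgent) :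
    R.trader H (.quad q a) = quadAgents H (.quad q) a := rfl

theorem trader_special :
    R.trader H .special = ⟨unit (.price R.s) 1, unit (.price R.s) 1⟩ := rfl

theorem goodRel_apply_excl (k k' : K) : (R.goodRel k).lhs (.excl k') = 0 ∧
    (R.goodRel k).rhs (.price R.s) (.excl k') = 0 := by
  unfold goodRel
  cases R.linRel k <;> simp [LinRel.map, LinRel.lhs, LinRel.rhs, unit_apply]

theorem goodRel_apply_quadExcl (k : K) (q : Q) (e : QuadLin) :
    (R.goodRel k).lhs (.quadExcl q e) = 0 ∧
      (R.goodRel k).rhs (.price R.s) (.quadExcl q e) = 0 := by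
  unfold goodRel
  cases R.linRel k <;> simp [LinRel.map, LinRel.lhs, LinRel.rhs, unit_apply]

theorem goodQuadLin_apply_excl (q : Q) (e : QuadLin) (k : K) :
    (R.goodQuadLin H q e).lhs (.excl k) = 0 ∧
      (R.goodQuadLin H q e).rhs (.price R.s) (.excl k) = 0 := by
  cases e <;> simp [goodQuadLin, goodQuadRel, LeontiefReduction.quadLin, LinRel.lhs, LinRel.rhs,
    unit_apply]

theorem goodQuadLin_apply_quadExcl (q : Q) (e : QuadLin) (q' : Q) (e' : QuadLin) :
    (R.goodQuadLin H q e).lhs (.quadExcl q' e') = 0 ∧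
      (R.goodQuadLin H q e).rhs (.price R.s) (.quadExcl q' e') = 0 := by
  cases e <;> simp [goodQuadLin, goodQuadRel, LeontiefReduction.quadLin, LinRel.lhs, LinRel.rhs,
    unit_apply]

/-- The prices satisfy all relations of the system. The quadratic relations `p_a = p_b p_c / p_s`
are multiplied by `p_s`. -/
def Holds (v : V → ℝ) : Prop :=
  (∀ k, (R.linRel k).Holds R.s v) ∧
    ∀ q, v (R.quadRel q).a * v R.s = v (R.quadRel q).b * v (R.quadRel q).c

variable [Fintype V] [Fintype K] [Fintype Q]

theorem excess_special {p : MarketGood V K Q → ℝ} (hs : 0 < p (.price R.s))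
    (j : MarketGood V K Q) : (R.trader H .special).excess p j = 0 := by
  simp [trader_special, Trader.excess, Trader.level, cost_unit, hs.ne']

/-- The exclusive goods force all linear relations, so that the corresponding agents
trade among themselves, and the goods of the submarkets of quadratic relations have to be
cleared by the remaining agents. -/
theorem holds_of_isEquilibrium {p : MarketGood V K Q → ℝ} (h : (R.market H).IsEquilibrium p) :
    0 < p (.price R.s) ∧ R.Holds fun v => p (.price v) := by
  rw [Market.isEquilibrium_iff] at h
  obtain ⟨hp, hpos, hclear⟩ := h
  change ∀ i, 0 < cost p (R.trader H i).want at hpos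
  change ∀ j, ∑ i, (R.trader H i).excess p j ≤ 0 ∧
    (0 < p j → ∑ i, (R.trader H i).excess p j = 0) at hclear
  have hs : 0 < p (.price R.s) := by
    simpa [trader_special, cost_unit] using hpos .special
  have hquad0 : ∀ q j, (∀ x, j ≠ .quad q x) →
      ∑ a, (R.trader H (.quad q a)).excess p j = 0 := fun q j hj =>
    sum_excess_quadAgents_of_not_mem H _ p hj
  -- Only the two agents of the relation own or want its exclusive good.
  have hlin : ∀ k, (R.goodRel k).Holds (.price R.s) p := by
    intro k
    refine LinRel.holds_of_submarket (R.goodRel_apply_excl k k).1 (R.goodRel_apply_excl k k).2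
      (fun i => hpos (.lin k i)) ?_
    have := (hclear (.excl k)).1
    rw [MarketAgent.sum_eq, R.excess_special H hs,
      Finset.sum_eq_zero fun q _ => hquad0 q _ (by simp),
      Finset.sum_eq_single k, Finset.sum_eq_zero (s := (Finset.univ : Finset Q))] at this
    · simpa [trader_lin] using this
    · intro q _
      refine Finset.sum_eq_zero fun e _ => ?_
      exact LinRel.sum_excess_eq_zero_of_not_mem (R.goodQuadLin_apply_excl H q e k).1
        (R.goodQuadLin_apply_excl H q e k).2 (by simp)
    · intro k' _ hk
      exact LinRel.sum_excess_eq_zero_of_not_mem (R.goodRel_apply_excl k' k).1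
        (R.goodRel_apply_excl k' k).2 (by simpa using hk.symm)
    · simp
  have hqlin : ∀ q e, (R.goodQuadLin H q e).Holds (.price R.s) p := by
    intro q e
    refine LinRel.holds_of_submarket (R.goodQuadLin_apply_quadExcl H q e q e).1
      (R.goodQuadLin_apply_quadExcl H q e q e).2 (fun i => hpos (.quadLin q e i)) ?_
    have := (hclear (.quadExcl q e)).1
    rw [MarketAgent.sum_eq, R.excess_special H hs,
      Finset.sum_eq_zero fun q _ => hquad0 q _ (by simp),
      Finset.sum_eq_zero (s := (Finset.univ : Finset K)), Finset.sum_eq_single q,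
      Finset.sum_eq_single e] at this
    · simpa [trader_quadLin] using this
    · intro e' _ he
      exact LinRel.sum_excess_eq_zero_of_not_mem (R.goodQuadLin_apply_quadExcl H q e' q e).1
        (R.goodQuadLin_apply_quadExcl H q e' q e).2 (by simpa using he.symm)
    · simp
    · intro q' _ hq
      refine Finset.sum_eq_zero fun e' _ => ?_
      exact LinRel.sum_excess_eq_zero_of_not_mem (R.goodQuadLin_apply_quadExcl H q' e' q e).1
        (R.goodQuadLin_apply_quadExcl H q' e' q e).2 (by simp [hq.symm])
    · simp
    · intro k _
      exact LinRel.sum_excess_eq_zero_of_not_mem (R.goodRel_apply_quadExcl k q e).1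
        (R.goodRel_apply_quadExcl k q e).2 (by simp)
  have hexlin : ∀ k j, ∑ i, (R.trader H (.lin k i)).excess p j = 0 := fun k j =>
    LinRel.sum_excess_eq_zero (fun i => hpos (.lin k i)) (hlin k) j
  have hexqlin : ∀ q e j, ∑ i, (R.trader H (.quadLin q e i)).excess p j = 0 := fun q e j =>
    LinRel.sum_excess_eq_zero (fun i => hpos (.quadLin q e i)) (hqlin q e) j
  refine ⟨hs, fun k => (LinRel.holds_map _ _ _ _).1 (hlin k), fun q => ?_⟩
  refine quadratic_of_equilibrium (ρ := R.goodQuadRel q) (g := .quad q)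
    (fun x y h => (MarketGood.quad.inj h).2) hs (hp _) (hqlin q) fun x hx => ?_
  have := (hclear (.quad q x)).2 hx
  rw [MarketAgent.sum_eq, R.excess_special H hs, Finset.sum_eq_single q] at this
  · simpa [hexlin, hexqlin, trader_quad] using this
  · intro q' _ hq
    exact hquad0 q' _ (by simp [hq.symm])
  · simp

/-- The equilibrium prices that extend a solution `v` of the relations. The exclusive goods of the
linear relations may have any positive price. -/
def extend (v : V → ℝ) : MarketGood V K Q → ℝ
  | .price x => v x
  | .quad q x => quadPrice H (v (R.quadRel q).b) (v (R.quadRel q).c) x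
  | .excl _ => 1
  | .quadExcl _ _ => 1

/-- The upper bounds on the second factors of the products ensure that the prices of the internal
goods of the devices are nonnegative. -/
theorem isEquilibrium_extend (hH : 0 < H) {v : V → ℝ} (hv : ∀ x, 0 ≤ v x) (hs : v R.s = 1)
    (hR : R.Holds v) (hbound : ∀ q, v (R.quadRel q).c ≤ H) :
    (R.market H).IsEquilibrium (R.extend H v) := by
  have hp : ∀ j, 0 ≤ R.extend H v j := by
    rintro (x | ⟨q, x⟩ | k | ⟨q, e⟩)
    · exact hv x
    · exact quadPrice_nonneg (hv _) (hv _) (hbound q) x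
    · exact zero_le_one
    · exact zero_le_one
  have hs' : R.extend H v (.price R.s) = 1 := hs
  have hq : ∀ q x, R.extend H v (.quad q x) =
      quadPrice H (v (R.quadRel q).b) (v (R.quadRel q).c) x := fun _ _ => rfl
  have hlin : ∀ k, (R.goodRel k).Holds (.price R.s) (R.extend H v) := fun k =>
    (LinRel.holds_map _ _ _ _).2 (hR.1 k)
  have hqlin : ∀ q e, (R.goodQuadLin H q e).Holds (.price R.s) (R.extend H v) := fun q e => by
    refine quadLin_holds_of_quadPrice hs' ?_ (hq q) e
    have := hR.2 q
    rwa [hs, mul_one] at this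
  have hpos : ∀ i, 0 < cost (R.extend H v) (R.trader H i).want := by
    rintro (_ | ⟨q, a⟩ | ⟨k, i⟩ | ⟨q, e, i⟩)
    · simp [trader_special, cost_unit, hs']
    · rw [trader_quad]
      exact cost_quadAgents_want_pos hH (hv (R.quadRel q).b) (hq q) a
    · rw [trader_lin]
      refine LinRel.cost_want_pos _ hp ?_ i
      exact zero_lt_one' ℝ
    · rw [trader_quadLin]
      refine LinRel.cost_want_pos _ hp ?_ i
      exact zero_lt_one' ℝ
  have hclear : ∀ j, ∑ i, (R.trader H i).excess (R.extend H v) j = 0 := by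
    intro j
    have h1 : ∀ q, ∑ a, (R.trader H (.quad q a)).excess (R.extend H v) j = 0 := fun q => by
      simp only [trader_quad]
      exact sum_excess_quadAgents_eq_zero hH (fun x y h => (MarketGood.quad.inj h).2)
        (hv (R.quadRel q).b) (hq q) j
    have h2 : ∀ k, ∑ i, (R.trader H (.lin k i)).excess (R.extend H v) j = 0 := fun k =>
      LinRel.sum_excess_eq_zero (fun i => hpos (.lin k i)) (hlin k) j
    have h3 : ∀ q e, ∑ i, (R.trader H (.quadLin q e i)).excess (R.extend H v) j = 0 :=
      fun q e => LinRel.sum_excess_eq_zero (fun i => hpos (.quadLin q e i)) (hqlin q e) j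
    rw [MarketAgent.sum_eq, R.excess_special H (hs' ▸ zero_lt_one)]
    simp [h1, h2, h3]
  exact (Market.isEquilibrium_iff _ _).2
    ⟨hp, hpos, fun j => ⟨(hclear j).le, fun _ => hclear j⟩⟩

end RelSystem

end RelSystem

/-! ### Solutions of the polynomial system and of the relations -/

theorem Mono.prod_factors {n : ℕ} (μ : Mono n) (z : Fin n → ℝ) :
    (μ.factors.map z).prod = ∏ j, z j ^ μ.exp j := by
  have h : ∀ l : List (Fin n), ((l.flatMap fun j => List.replicate (μ.exp j) j).map z).prod =
      (l.map fun j => z j ^ μ.exp j).prod := fun l => by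
    induction l with
    | nil => rfl
    | cons j l ih => simp [ih]
  rw [Mono.factors, h, ← List.prod_ofFn, List.ofFn_eq_map]

theorem Mono.length_factors {n : ℕ} (μ : Mono n) : μ.factors.length = μ.degree := by
  simp [Mono.factors, Mono.degree, List.length_flatMap, ← List.ofFn_eq_map, List.sum_ofFn]

/-- The term of a polynomial with its coefficient `α` replaced by `max α 0`. -/
noncomputable def Mono.posPart {n : ℕ} (z : Fin n → ℝ) (μ : Mono n) : ℝ :=
  (Rat.toNNRat μ.coeff : ℝ) * ∏ j, z j ^ μ.exp j

/-- The term of a polynomial with its coefficient `α` replaced by `max (-α) 0`. -/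
noncomputable def Mono.negPart {n : ℕ} (z : Fin n → ℝ) (μ : Mono n) : ℝ :=
  (Rat.toNNRat (-μ.coeff) : ℝ) * ∏ j, z j ^ μ.exp j

theorem Mono.posPart_sub_negPart {n : ℕ} (z : Fin n → ℝ) (μ : Mono n) :
    μ.posPart z - μ.negPart z = μ.eval z := by
  rw [posPart, negPart, eval, ← sub_mul]
  congr 1
  have h : ((Rat.toNNRat μ.coeff : ℚ) - (Rat.toNNRat (-μ.coeff) : ℚ)) = μ.coeff := by
    rcases le_total μ.coeff 0 with h | h
    · rw [Rat.toNNRat_of_nonpos h, Rat.coe_toNNRat _ (neg_nonneg.2 h)]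
      simp
    · rw [Rat.toNNRat_of_nonpos (neg_nonpos.2 h), Rat.coe_toNNRat _ h]
      simp
  simpa using congrArg (Rat.cast : ℚ → ℝ) h

theorem sum_map_sub {α : Type} (l : List α) (f g : α → ℝ) :
    (l.map f).sum - (l.map g).sum = (l.map fun x => f x - g x).sum := by
  induction l with
  | nil => simp
  | cons x l ih => simp only [List.map_cons, List.sum_cons, ← ih]; ring

namespace PolySystem

variable (F : PolySystem)

theorem sum_eval_eq (z : Fin F.n → ℝ) (i : Fin F.m) :
    ((F.poly i).map fun μ => μ.eval z).sum =
      ((F.poly i).map (Mono.posPart z)).sum - ((F.poly i).map (Mono.negPart z)).sum := by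
  simp only [sum_map_sub, Mono.posPart_sub_negPart]

/-- If the prices of the partial products of a monomial are correct, so is the price that carries
its value, also in degree zero and one. -/
theorem monoVar_eq {v : F.PriceVar → ℝ} (hs : v .s = 1) (k : F.MonoIdx)
    (h : ∀ t ht, v (F.chainVar k t ht) =
      (((F.mono k).factors.map fun j => v (.z j)).take (t + 1)).prod) :
    v (F.monoVar k) = ∏ j, v (.z j) ^ (F.mono k).exp j := by
  rw [← Mono.prod_factors (F.mono k) fun j => v (.z j)]
  unfold monoVar
  split_ifs with h0
  · simp [List.length_eq_zero_iff.1 h0, hs]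
  · rw [h, List.take_of_length_le (by simp; omega)]

/-- The quadratic relations determine the prices of the partial products. -/
theorem chainVar_eq {v : F.PriceVar → ℝ} (hs : v .s = 1) (hv : F.relSystem.Holds v)
    (k : F.MonoIdx) (t : ℕ) (ht : t < (F.mono k).factors.length) : v (F.chainVar k t ht) =
      (((F.mono k).factors.map fun j => v (.z j)).take (t + 1)).prod := by
  induction t with
  | zero => rw [List.prod_take_succ _ _ (by simpa using ht)]; simp [chainVar]
  | succ t ih =>
    have := hv.2 ⟨k, ⟨t, by omega⟩⟩
    simp only [relSystem, quadRel, hs, mul_one] at this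
    rw [List.prod_take_succ _ _ (by simpa using ht), ← ih (by omega)]
    simpa [chainVar] using this

theorem mem_solutions_of_holds {v : F.PriceVar → ℝ} (hs : v .s = 1) (hv : F.relSystem.Holds v)
    (h0 : ∀ x, 0 ≤ v x) : (fun j => v (.z j)) ∈ F.solutions := by
  have hmono := fun k => F.monoVar_eq hs k (F.chainVar_eq hs hv k)
  have hpos : ∀ i t (ht : t < (F.poly i).length + 1), v (.pos ⟨i, ⟨t, ht⟩⟩) =
      (((F.poly i).map (Mono.posPart fun j => v (.z j))).take t).sum := by
    intro i t ht
    induction t with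
    | zero => simpa [relSystem, linRel, LinRel.Holds] using hv.1 (.posZero i)
    | succ t ih =>
      have := hv.1 (.posStep ⟨i, ⟨t, by omega⟩⟩)
      simp only [relSystem, linRel, LinRel.Holds, hmono] at this
      rw [List.sum_take_succ _ _ (by simpa using ht), ← ih (by omega)]
      simpa [Mono.posPart, mono] using this
  have hneg : ∀ i t (ht : t < (F.poly i).length + 1), v (.neg ⟨i, ⟨t, ht⟩⟩) =
      (((F.poly i).map (Mono.negPart fun j => v (.z j))).take t).sum := by
    intro i t ht
    induction t with
    | zero => simpa [relSystem, linRel, LinRel.Holds] using hv.1 (.negZero i)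
    | succ t ih =>
      have := hv.1 (.negStep ⟨i, ⟨t, by omega⟩⟩)
      simp only [relSystem, linRel, LinRel.Holds, hmono] at this
      rw [List.sum_take_succ _ _ (by simpa using ht), ← ih (by omega)]
      simpa [Mono.negPart, mono] using this
  refine ⟨fun i => ?_, fun j => ?_⟩
  · have hbal : v (.pos ⟨i, Fin.last _⟩) = v (.neg ⟨i, Fin.last _⟩) := hv.1 (.balance i)
    rw [Fin.last, hpos, hneg, List.take_of_length_le (by simp),
      List.take_of_length_le (by simp)] at hbal
    rw [sum_eval_eq, hbal, sub_self]
  · have h1 := hv.1 (.lower j)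
    have h2 := hv.1 (.capSum j)
    have h3 := hv.1 (.capVal j)
    simp [relSystem, linRel, LinRel.Holds, hs] at h1 h2 h3
    have := h0 (.lo j)
    have := h0 (.up j)
    constructor <;> linarith

/-- The values of the price variables that belong to a point `z`. -/
noncomputable def value (z : Fin F.n → ℝ) : F.PriceVar → ℝ
  | .s => 1
  | .z j => z j
  | .lo j => z j - F.L j
  | .up j => F.U j - z j
  | .cap j => F.U j
  | .prod ⟨k, t⟩ => (((F.mono k).factors.map z).take (t + 2)).prod
  | .pos ⟨i, t⟩ => (((F.poly i).map (Mono.posPart z)).take t).sum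
  | .neg ⟨i, t⟩ => (((F.poly i).map (Mono.negPart z)).take t).sum

theorem value_chainVar (z : Fin F.n → ℝ) (k : F.MonoIdx) (t : ℕ)
    (ht : t < (F.mono k).factors.length) : F.value z (F.chainVar k t ht) =
      (((F.mono k).factors.map z).take (t + 1)).prod := by
  cases t with
  | zero => rw [List.prod_take_succ _ _ (by simpa using ht)]; simp [chainVar, value]
  | succ t => rfl

variable {F}

theorem value_nonneg {z : Fin F.n → ℝ} (hz : z ∈ F.solutions) (x : F.PriceVar) :
    0 ≤ F.value z x := by
  have h0 : ∀ j, 0 ≤ z j := fun j => (NNRat.cast_nonneg _).trans (hz.2 j).1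
  have hprod : ∀ μ : Mono F.n, 0 ≤ ∏ j, z j ^ μ.exp j := fun μ =>
    Finset.prod_nonneg fun j _ => pow_nonneg (h0 j) _
  cases x with
  | s => exact zero_le_one
  | z j => exact h0 j
  | lo j => exact sub_nonneg.2 (hz.2 j).1
  | up j => exact sub_nonneg.2 (hz.2 j).2
  | cap j => exact NNRat.cast_nonneg _
  | prod q =>
    refine List.prod_nonneg fun x hx => ?_
    obtain ⟨j, -, rfl⟩ := List.mem_map.1 (List.mem_of_mem_take hx)
    exact h0 j
  | pos k =>
    refine List.sum_nonneg fun x hx => ?_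
    obtain ⟨μ, -, rfl⟩ := List.mem_map.1 (List.mem_of_mem_take hx)
    exact mul_nonneg (NNRat.cast_nonneg _) (hprod μ)
  | neg k =>
    refine List.sum_nonneg fun x hx => ?_
    obtain ⟨μ, -, rfl⟩ := List.mem_map.1 (List.mem_of_mem_take hx)
    exact mul_nonneg (NNRat.cast_nonneg _) (hprod μ)

theorem holds_value {z : Fin F.n → ℝ} (hz : z ∈ F.solutions) : F.relSystem.Holds (F.value z) := by
  have hmono : ∀ k, F.value z (F.monoVar k) = ∏ j, z j ^ (F.mono k).exp j := fun k =>
    F.monoVar_eq (v := F.value z) rfl k (F.value_chainVar z k)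
  refine ⟨fun k => ?_, fun q => ?_⟩
  · cases k with
    | lower j => simp [relSystem, linRel, LinRel.Holds, value]
    | capSum j => simp [relSystem, linRel, LinRel.Holds, value]
    | capVal j => simp [relSystem, linRel, LinRel.Holds, value]
    | posZero i => simp [relSystem, linRel, LinRel.Holds, value]
    | posStep k =>
      simp only [relSystem, linRel, LinRel.Holds, hmono]
      simp only [value, Fin.val_succ]
      rw [List.sum_take_succ _ _ (by simp)]
      simp [Mono.posPart, mono]
    | negZero i => simp [relSystem, linRel, LinRel.Holds, value]
    | negStep k =>
      simp only [relSystem, linRel, LinRel.Holds, hmono]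
      simp only [value, Fin.val_succ]
      rw [List.sum_take_succ _ _ (by simp)]
      simp [Mono.negPart, mono]
    | balance i =>
      have := hz.1 i
      rw [sum_eval_eq, sub_eq_zero] at this
      simpa [relSystem, linRel, LinRel.Holds, value, List.take_of_length_le] using this
  · obtain ⟨k, t⟩ := q
    simp only [relSystem, quadRel, value_chainVar]
    simp only [value]
    rw [List.prod_take_succ _ (t.1 + 1) (by have := t.2; simp; omega)]
    simp

/-- If the system has a monomial of degree at least two, the constant `H` is at least
every upper bound. -/
theorem le_bound_of_prodIdx (q : F.ProdIdx) (j : Fin F.n) : F.U j ≤ F.bound := by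
  obtain ⟨⟨i, k⟩, t⟩ := q
  have hM : 1 ≤ F.maxMonos := by
    have : (F.poly i).length ≤ F.maxMonos :=
      Finset.le_sup (f := fun i => (F.poly i).length) (Finset.mem_univ i)
    have := k.2
    omega
  have hdeg := (F.mono ⟨i, k⟩).length_factors
  have hd : F.maxDegree ≠ 0 := by
    have h1 : (F.mono ⟨i, k⟩).degree ≤ F.polyDegree i :=
      Finset.le_sup (f := fun k => (F.mono ⟨i, k⟩).degree) (Finset.mem_univ k)
    have h2 : F.polyDegree i ≤ F.maxDegree := Finset.le_sup (Finset.mem_univ i)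
    have := t.2
    omega
  have hU : F.U j ≤ F.maxValue :=
    (Finset.le_sup (f := F.U) (Finset.mem_univ j)).trans (le_max_left _ _)
  refine hU.trans ?_
  unfold bound
  -- A power of `U_max` is at least `U_max` only if `U_max ≥ 1`; otherwise the summand `1` suffices.
  rcases le_total F.maxValue 1 with h | h
  · exact h.trans le_add_self
  · calc F.maxValue ≤ F.maxValue ^ F.maxDegree := le_self_pow₀ h hd
      _ ≤ F.maxMonos * F.maxValue ^ F.maxDegree :=
        le_mul_of_one_le_left zero_le (by exact_mod_cast hM)
      _ ≤ _ := le_self_add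

variable (F)

theorem image_isEquilibrium_eq_solutions :
    (fun (p : F.Good → ℝ) (j : Fin F.n) => p (F.varGood j)) ''
      {p | F.market.IsEquilibrium p ∧ p F.specialGood = 1} = F.solutions := by
  ext z
  constructor
  · rintro ⟨p, ⟨hp, hs⟩, rfl⟩
    exact F.mem_solutions_of_holds (v := fun v => p (.price v)) hs
      (F.relSystem.holds_of_isEquilibrium F.bound hp).2 fun x => hp.1 _
  · intro hz
    refine ⟨F.relSystem.extend F.bound (F.value z), ⟨?_, rfl⟩, rfl⟩
    refine F.relSystem.isEquilibrium_extend F.bound (add_pos_of_nonneg_of_pos zero_le one_pos)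
      (value_nonneg hz) rfl (holds_value hz) fun q => ?_
    refine (hz.2 _).2.trans ?_
    exact_mod_cast le_bound_of_prodIdx q _

end PolySystem

/-! ### Bit sizes of numbers -/

theorem natSize_le_self (n : ℕ) : Nat.size n ≤ n := Nat.size_le.2 Nat.lt_two_pow_self

theorem natSize_mul_le (a b : ℕ) : Nat.size (a * b) ≤ Nat.size a + Nat.size b := by
  rw [Nat.size_le, pow_add]
  exact Nat.mul_lt_mul'' (Nat.lt_size_self a) (Nat.lt_size_self b)

theorem natSize_add_le (a b : ℕ) : Nat.size (a + b) ≤ Nat.size a + Nat.size b + 1 := by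
  rw [Nat.size_le, pow_succ, mul_two]
  exact add_lt_add
    ((Nat.lt_size_self a).trans_le (Nat.pow_le_pow_right two_pos (Nat.le_add_right _ _)))
    ((Nat.lt_size_self b).trans_le (Nat.pow_le_pow_right two_pos (Nat.le_add_left _ _)))

theorem one_le_ratSize (x : ℚ) : 1 ≤ ratSize x :=
  (Nat.size_pos.2 x.den_pos).trans_le (Nat.le_add_left _ _)

theorem ratSize_zero : ratSize 0 = 1 := by simp [ratSize]

theorem ratSize_one : ratSize 1 = 2 := by simp [ratSize]

theorem ratSize_natCast_le (n : ℕ) : ratSize n ≤ n + 1 := by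
  simpa [ratSize] using natSize_le_self n

theorem ratSize_abs (x : ℚ) : ratSize |x| = ratSize x := by
  rcases abs_choice x with h | h <;> simp [h, ratSize]

/-- Reducing a fraction does not increase its size. -/
theorem ratSize_divInt_le (a : ℤ) {b : ℕ} (hb : b ≠ 0) :
    ratSize (Rat.divInt a b) ≤ Nat.size a.natAbs + Nat.size b := by
  refine Nat.add_le_add (Nat.size_le_size ?_) (Nat.size_le_size ?_)
  · rcases eq_or_ne a 0 with rfl | ha
    · simp
    · exact Nat.le_of_dvd (Int.natAbs_pos.2 ha)
        (Int.natAbs_dvd_natAbs.2 (Rat.num_dvd a (by exact_mod_cast hb)))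
  · exact Nat.le_of_dvd (Nat.pos_of_ne_zero hb) (by exact_mod_cast Rat.den_dvd a b)

theorem ratSize_mul_le (x y : ℚ) : ratSize (x * y) ≤ ratSize x + ratSize y := by
  have h : x * y = Rat.divInt (x.num * y.num) ((x.den * y.den : ℕ) : ℤ) := by
    rw [Rat.divInt_eq_div]
    push_cast
    rw [mul_div_mul_comm, Rat.num_div_den, Rat.num_div_den]
  rw [h]
  refine (ratSize_divInt_le _ (mul_ne_zero x.den_nz y.den_nz)).trans ?_
  rw [Int.natAbs_mul]
  have := natSize_mul_le x.num.natAbs y.num.natAbs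
  have := natSize_mul_le x.den y.den
  unfold ratSize
  omega

theorem ratSize_add_le (x y : ℚ) : ratSize (x + y) ≤ 2 * (ratSize x + ratSize y) + 1 := by
  have h : x + y = Rat.divInt (x.num * y.den + y.num * x.den) ((x.den * y.den : ℕ) : ℤ) := by
    rw [Rat.divInt_eq_div]
    push_cast
    have hx : (x.den : ℚ) ≠ 0 := by exact_mod_cast x.den_nz
    have hy : (y.den : ℚ) ≠ 0 := by exact_mod_cast y.den_nz
    conv_lhs => rw [← Rat.num_div_den x, ← Rat.num_div_den y, div_add_div _ _ hx hy]
    ring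
  rw [h]
  refine (ratSize_divInt_le _ (mul_ne_zero x.den_nz y.den_nz)).trans ?_
  have h1 := Nat.size_le_size (Int.natAbs_add_le (x.num * y.den) (y.num * x.den))
  rw [Int.natAbs_mul, Int.natAbs_mul, Int.natAbs_natCast, Int.natAbs_natCast] at h1
  have := natSize_add_le (x.num.natAbs * y.den) (y.num.natAbs * x.den)
  have := natSize_mul_le x.num.natAbs y.den
  have := natSize_mul_le y.num.natAbs x.den
  have := natSize_mul_le x.den y.den
  unfold ratSize
  omega

theorem ratSize_pow_le (x : ℚ) (d : ℕ) : ratSize (x ^ d) ≤ d * ratSize x + 2 := by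
  induction d with
  | zero => simp [ratSize_one]
  | succ d ih =>
    rw [pow_succ, Nat.succ_mul]
    have := ratSize_mul_le (x ^ d) x
    omega

theorem ratSize_toNNRat_le (x : ℚ) : ratSize (Rat.toNNRat x) ≤ ratSize x := by
  rcases le_total x 0 with h | h
  · rw [Rat.toNNRat_of_nonpos h, NNRat.coe_zero, ratSize_zero]
    exact one_le_ratSize x
  · rw [Rat.coe_toNNRat _ h]

/-! ### Sizes of the traders -/

section Bundles

variable {G : Type}

/-- All coefficients of the bundle have size at most `b`. -/
def BundleLE (b : ℕ) (v : G → NNRat) : Prop := ∀ j, ratSize (v j) ≤ b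

theorem BundleLE.add {b c : ℕ} {v w : G → NNRat} (hv : BundleLE b v) (hw : BundleLE c w) :
    BundleLE (2 * (b + c) + 1) (v + w) := fun j => by
  have := hv j
  have := hw j
  have := ratSize_add_le (v j) (w j)
  rw [Pi.add_apply, NNRat.coe_add]
  omega

theorem BundleLE.mono {b c : ℕ} {v : G → NNRat} (hv : BundleLE b v) (h : b ≤ c) :
    BundleLE c v := fun j => (hv j).trans h

theorem bundleLE_unit [DecidableEq G] (g : G) {c : NNRat} {b : ℕ} (hc : ratSize c ≤ b) :
    BundleLE b (unit g c) := fun j => by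
  rw [unit_apply]
  split_ifs
  · exact hc
  · rw [NNRat.coe_zero, ratSize_zero]
    exact (one_le_ratSize _).trans hc

theorem bundleLE_unit_one [DecidableEq G] (g : G) {b : ℕ} (hb : 2 ≤ b) :
    BundleLE b (unit g 1) := bundleLE_unit g (by rwa [NNRat.coe_one, ratSize_one])

theorem BundleLE.bundleSize_le [Fintype G] {b : ℕ} {v : G → NNRat} (hv : BundleLE b v) :
    bundleSize v ≤ Fintype.card G * (Fintype.card G + b) := by
  rw [← smul_eq_mul, ← Finset.card_univ]
  refine Finset.sum_le_card_nsmul _ _ _ fun j _ => ?_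
  split_ifs
  · exact Nat.zero_le _
  · exact add_le_add (natSize_le_self _) (hv j)

/-- Every bundle is bounded as if all its coefficients were nonzero. -/
theorem Market.size_le {I : Type} [Fintype G] [Fintype I] (M : Market G I) {b : ℕ}
    (h : ∀ i, BundleLE b (M.trader i).endow ∧ BundleLE b (M.trader i).want) :
    M.size ≤ Fintype.card G + Fintype.card I +
      Fintype.card I * (2 * (Fintype.card G * (Fintype.card G + b))) := by
  refine Nat.add_le_add_left ?_ _
  rw [← smul_eq_mul (a := Fintype.card I), ← Finset.card_univ (α := I)]
  refine Finset.sum_le_card_nsmul _ _ _ fun i _ => ?_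
  have := (h i).1.bundleSize_le
  have := (h i).2.bundleSize_le
  omega

/-- The coefficients in a linear relation have size at most `b`. -/
def LinRel.CoeffLE (b : ℕ) : LinRel G → Prop
  | .eq _ _ => True
  | .lin _ B _ C _ D => ratSize B ≤ b ∧ ratSize C ≤ b ∧ ratSize D ≤ b

theorem LinRel.CoeffLE.map {W : Type} {b : ℕ} {ρ : LinRel G} (h : ρ.CoeffLE b) (f : G → W) :
    (ρ.map f).CoeffLE b := by
  cases ρ <;> exact h

theorem coeffLE_quadLin {b : ℕ} (hb : 2 ≤ b) {H : NNRat} (hH : ratSize H ≤ b) (s : G)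
    (ρ : QuadRel G) (g : QuadGood → G) (e : QuadLin) : (quadLin H s ρ g e).CoeffLE b := by
  have h0 : (1 : ℕ) ≤ b := by omega
  cases e <;> simp [quadLin, LinRel.CoeffLE, ratSize_zero, ratSize_one, hH, hb, h0]

variable [DecidableEq G]

/-- Each bundle of the two agents is a sum of at most four units, and each addition turns bounds
`b` and `c` into `2 * (b + c) + 1`; this gives `5 * b`, `13 * b` and `29 * b`. -/
theorem LinRel.bundleLE_submarket {b : ℕ} (hb : 2 ≤ b) (s r : G) {ρ : LinRel G}
    (hρ : ρ.CoeffLE b) (i : Fin 2) : BundleLE (29 * b) (ρ.submarket s r i).endow ∧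
      BundleLE (29 * b) (ρ.submarket s r i).want := by
  have h1 : ∀ g : G, BundleLE b (unit g 1) := fun g => bundleLE_unit_one g hb
  have hl : BundleLE (29 * b) (ρ.lhs + unit r 1) := by
    cases ρ <;> exact ((h1 _).add (h1 _)).mono (by omega)
  have hr : BundleLE (29 * b) (ρ.rhs s + unit r 1) := by
    cases ρ with
    | eq => exact ((h1 _).add (h1 _)).mono (by omega)
    | lin a B b' C c D =>
      exact ((((bundleLE_unit _ hρ.1).add (bundleLE_unit _ hρ.2.1)).add
        (bundleLE_unit _ hρ.2.2)).add (h1 _)).mono (by omega)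
  revert i
  rw [LinRel.forall_submarket s r ρ fun T => BundleLE (29 * b) T.endow ∧ BundleLE (29 * b) T.want]
  exact ⟨⟨hl, hr⟩, hr, hl⟩

theorem bundleLE_quadAgents {b : ℕ} (hb : 2 ≤ b) {H : NNRat} (hH : ratSize H ≤ b)
    (g : QuadGood → G) (a : QuadAgent) : BundleLE (29 * b) (quadAgents H g a).endow ∧
      BundleLE (29 * b) (quadAgents H g a).want := by
  have h1 : ∀ x : G, BundleLE b (unit x 1) := fun x => bundleLE_unit_one x hb
  have hHu : ∀ x : G, BundleLE b (unit x H) := fun x => bundleLE_unit x hH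
  have h1' : ∀ x : G, BundleLE (29 * b) (unit x 1) := fun x => (h1 x).mono (by omega)
  have hHu' : ∀ x : G, BundleLE (29 * b) (unit x H) := fun x => (hHu x).mono (by omega)
  have h2 : ∀ x y : G, BundleLE (29 * b) (unit x 1 + unit y 1) := fun x y =>
    ((h1 x).add (h1 y)).mono (by omega)
  have h3 : ∀ x y : G, BundleLE (29 * b) (unit x H + unit y H) := fun x y =>
    ((hHu x).add (hHu y)).mono (by omega)
  rcases a with _ | _ | i | i | i | i
  rotate_left 2
  all_goals
    try fin_cases i
  all_goals
    simp [quadAgents, converter, combiner, splitter, h1', hHu', h2, h3]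

end Bundles

section RelSystem

variable {V K Q : Type}

theorem card_marketGood_le [Fintype V] [Fintype K] [Fintype Q] : Fintype.card (MarketGood V K Q) ≤
    Fintype.card V + Fintype.card K + 32 * Fintype.card Q := by
  let f : V ⊕ (Q × QuadGood) ⊕ K ⊕ (Q × QuadLin) → MarketGood V K Q :=
    Sum.elim .price (Sum.elim (fun x => .quad x.1 x.2) (Sum.elim .excl fun x => .quadExcl x.1 x.2))
  have hf : Function.Surjective f := by
    rintro (v | ⟨q, g⟩ | k | ⟨q, e⟩)
    · exact ⟨.inl v, rfl⟩
    · exact ⟨.inr (.inl (q, g)), rfl⟩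
    · exact ⟨.inr (.inr (.inl k)), rfl⟩
    · exact ⟨.inr (.inr (.inr (q, e))), rfl⟩
  have h1 : Fintype.card QuadGood = 17 := rfl
  have h2 : Fintype.card QuadLin = 15 := rfl
  have := Fintype.card_le_of_surjective f hf
  simp only [Fintype.card_sum, Fintype.card_prod, h1, h2] at this
  omega

theorem card_marketAgent [Fintype K] [Fintype Q] : Fintype.card (MarketAgent K Q) =
    1 + 2 * Fintype.card K + 42 * Fintype.card Q := by
  have h1 : Fintype.card QuadAgent = 12 := rfl
  have h2 : Fintype.card QuadLin = 15 := rfl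
  rw [Fintype.card_congr (MarketAgent.equivSum K Q)]
  simp only [Fintype.card_sum, Fintype.card_prod, Fintype.card_unit, Fintype.card_fin, h1, h2]
  omega

variable [DecidableEq V] [DecidableEq K] [DecidableEq Q]

theorem RelSystem.bundleLE_trader (R : RelSystem V K Q) {H : NNRat} {b : ℕ} (hb : 2 ≤ b)
    (hH : ratSize H ≤ b) (hR : ∀ k, (R.linRel k).CoeffLE b) (i : MarketAgent K Q) :
    BundleLE (29 * b) (R.trader H i).endow ∧ BundleLE (29 * b) (R.trader H i).want := by
  rcases i with _ | ⟨q, a⟩ | ⟨k, i⟩ | ⟨q, e, i⟩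
  · have : BundleLE (29 * b) (unit (MarketGood.price (K := K) (Q := Q) R.s) 1) :=
      bundleLE_unit_one _ (by omega)
    exact ⟨this, this⟩
  · exact bundleLE_quadAgents hb hH _ a
  · exact LinRel.bundleLE_submarket hb _ _ ((hR k).map _) i
  · exact LinRel.bundleLE_submarket hb _ _ (coeffLE_quadLin hb hH _ _ _ e) i

end RelSystem

/-! ### The size of the market of a polynomial system -/

namespace PolySystem

variable (F : PolySystem)

theorem sum_polySize_le : ∑ i, ((F.poly i).map Mono.size).sum ≤ F.size := by
  unfold size
  rw [Finset.sum_add_distrib (s := (Finset.univ : Finset (Fin F.m)))]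
  omega

theorem polyDegree_le_size (i : Fin F.m) : F.polyDegree i ≤ F.size := by
  have := Finset.single_le_sum (f := F.polyDegree) (fun _ _ => Nat.zero_le _) (Finset.mem_univ i)
  unfold size
  rw [Finset.sum_add_distrib (s := (Finset.univ : Finset (Fin F.m)))]
  omega

/-- Every monomial has positive size, as the denominator of its coefficient is not zero. -/
theorem length_le_polySize (i : Fin F.m) :
    (F.poly i).length ≤ ((F.poly i).map Mono.size).sum := by
  have := List.length_le_sum_of_one_le ((F.poly i).map Mono.size) fun x hx => by
    obtain ⟨μ, -, rfl⟩ := List.mem_map.1 hx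
    exact (one_le_ratSize _).trans (Nat.le_add_right _ _)
  simpa using this

theorem card_monoIdx_le : Fintype.card F.MonoIdx ≤ F.size := by
  simp only [MonoIdx, Fintype.card_sigma, Fintype.card_fin]
  exact (Finset.sum_le_sum fun i _ => F.length_le_polySize i).trans F.sum_polySize_le

theorem n_add_m_le_size : F.n + F.m ≤ F.size := by
  unfold size
  omega

theorem degree_le_size (k : F.MonoIdx) : (F.mono k).degree ≤ F.size :=
  (Finset.le_sup (f := fun t => (F.mono ⟨k.1, t⟩).degree) (Finset.mem_univ k.2)).trans
    (F.polyDegree_le_size k.1)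

theorem card_prodIdx_le : Fintype.card F.ProdIdx ≤ F.size * F.size := by
  simp only [ProdIdx, Fintype.card_sigma, Fintype.card_fin]
  calc ∑ k, ((F.mono k).factors.length - 1) ≤ Fintype.card F.MonoIdx • F.size :=
        Finset.sum_le_card_nsmul _ _ _ fun k _ => by
          have := F.degree_le_size k
          rw [Mono.length_factors]
          omega
    _ ≤ F.size * F.size := Nat.mul_le_mul_right _ F.card_monoIdx_le

theorem card_sumIdx_le : Fintype.card F.SumIdx ≤ 2 * F.size := by
  have h := F.card_monoIdx_le
  have := F.n_add_m_le_size
  simp only [MonoIdx, SumIdx, Fintype.card_sigma, Fintype.card_fin, Finset.sum_add_distrib,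
    Finset.sum_const, Finset.card_univ, smul_eq_mul, mul_one] at h ⊢
  omega

theorem card_priceVar_le : Fintype.card F.PriceVar ≤ 1 + 8 * F.size + F.size * F.size := by
  let f : Unit ⊕ (Fin F.n ⊕ Fin F.n ⊕ Fin F.n ⊕ Fin F.n) ⊕ F.ProdIdx ⊕ F.SumIdx ⊕ F.SumIdx →
      F.PriceVar :=
    Sum.elim (fun _ => .s) (Sum.elim (Sum.elim .z (Sum.elim .lo (Sum.elim .up .cap)))
      (Sum.elim .prod (Sum.elim .pos .neg)))
  have hf : Function.Surjective f := by
    rintro (_ | j | j | j | j | q | k | k)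
    · exact ⟨.inl (), rfl⟩
    · exact ⟨.inr (.inl (.inl j)), rfl⟩
    · exact ⟨.inr (.inl (.inr (.inl j))), rfl⟩
    · exact ⟨.inr (.inl (.inr (.inr (.inl j)))), rfl⟩
    · exact ⟨.inr (.inl (.inr (.inr (.inr j)))), rfl⟩
    · exact ⟨.inr (.inr (.inl q)), rfl⟩
    · exact ⟨.inr (.inr (.inr (.inl k))), rfl⟩
    · exact ⟨.inr (.inr (.inr (.inr k))), rfl⟩
  have h := Fintype.card_le_of_surjective f hf
  rw [Fintype.card_sum, Fintype.card_sum, Fintype.card_sum, Fintype.card_sum, Fintype.card_sum,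
    Fintype.card_sum, Fintype.card_sum, Fintype.card_unit, Fintype.card_fin] at h
  have := F.card_prodIdx_le
  have := F.card_sumIdx_le
  have := F.n_add_m_le_size
  omega

theorem card_linIdx_le : Fintype.card F.LinIdx ≤ 5 * F.size := by
  let f : (Fin F.n ⊕ Fin F.n ⊕ Fin F.n) ⊕ (Fin F.m ⊕ Fin F.m ⊕ Fin F.m) ⊕
      F.MonoIdx ⊕ F.MonoIdx → F.LinIdx :=
    Sum.elim (Sum.elim .lower (Sum.elim .capSum .capVal))
      (Sum.elim (Sum.elim .posZero (Sum.elim .negZero .balance)) (Sum.elim .posStep .negStep))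
  have hf : Function.Surjective f := by
    rintro (j | j | j | i | k | i | k | i)
    · exact ⟨.inl (.inl j), rfl⟩
    · exact ⟨.inl (.inr (.inl j)), rfl⟩
    · exact ⟨.inl (.inr (.inr j)), rfl⟩
    · exact ⟨.inr (.inl (.inl i)), rfl⟩
    · exact ⟨.inr (.inr (.inl k)), rfl⟩
    · exact ⟨.inr (.inl (.inr (.inl i))), rfl⟩
    · exact ⟨.inr (.inr (.inr k)), rfl⟩
    · exact ⟨.inr (.inl (.inr (.inr i))), rfl⟩
  have h := Fintype.card_le_of_surjective f hf
  rw [Fintype.card_sum, Fintype.card_sum, Fintype.card_sum, Fintype.card_sum, Fintype.card_sum,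
    Fintype.card_sum, Fintype.card_sum, Fintype.card_fin, Fintype.card_fin] at h
  have := F.card_monoIdx_le
  have := F.n_add_m_le_size
  omega

theorem ratSize_U_add_ratSize_L_le (j : Fin F.n) :
    ratSize (F.U j) + ratSize (F.L j) ≤ F.size := by
  have := Finset.single_le_sum (f := fun j => ratSize (F.U j) + ratSize (F.L j))
    (fun _ _ => Nat.zero_le _) (Finset.mem_univ j)
  unfold size
  omega

theorem ratSize_coeff_le (k : F.MonoIdx) : ratSize (F.mono k).coeff ≤ F.size := by
  have h1 : (F.mono k).size ≤ ((F.poly k.1).map Mono.size).sum :=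
    List.single_le_sum (fun _ _ => Nat.zero_le _) _
      (List.mem_map_of_mem (List.get_mem (F.poly k.1) k.2))
  have h2 := Finset.single_le_sum (f := fun i => ((F.poly i).map Mono.size).sum)
    (fun _ _ => Nat.zero_le _) (Finset.mem_univ k.1)
  exact (Nat.le_add_right _ _).trans (h1.trans (h2.trans F.sum_polySize_le))

/-- The maximum is one of the listed numbers, or `0` (an empty maximum), which has size `1`. -/
theorem ratSize_maxValue_le : ratSize F.maxValue ≤ F.size + 1 := by
  have hmax : ∀ a : NNRat, ratSize a ≤ F.size + 1 → ∀ b : NNRat, ratSize b ≤ F.size + 1 →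
      ratSize (max a b : NNRat) ≤ F.size + 1 := fun a ha b hb => by
    rcases max_choice a b with h | h <;> rwa [h]
  have h0 : ratSize ((⊥ : NNRat) : ℚ) ≤ F.size + 1 := by
    change ratSize 0 ≤ _
    rw [ratSize_zero]
    omega
  refine hmax _ (Finset.sup_induction (p := fun x : NNRat => ratSize x ≤ F.size + 1) h0 hmax
    fun j _ => ?_) _ (Finset.sup_induction (p := fun x : NNRat => ratSize x ≤ F.size + 1) h0 hmax
    fun k _ => ?_)
  · have := F.ratSize_U_add_ratSize_L_le j
    omega
  · rw [Rat.coe_nnabs, ratSize_abs]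
    exact (F.ratSize_coeff_le k).trans (Nat.le_succ _)

theorem ratSize_bound_le : ratSize F.bound ≤ 2 * (F.size * F.size) + 4 * F.size + 11 := by
  have hM : F.maxMonos ≤ F.size := Finset.sup_le fun i _ =>
    (F.length_le_polySize i).trans ((Finset.single_le_sum
      (f := fun i => ((F.poly i).map Mono.size).sum)
      (fun _ _ => Nat.zero_le _) (Finset.mem_univ i)).trans F.sum_polySize_le)
  have hd : F.maxDegree ≤ F.size := Finset.sup_le fun i _ => F.polyDegree_le_size i
  have h1 := ratSize_add_le ((F.maxMonos : ℚ) * (F.maxValue : ℚ) ^ F.maxDegree) 1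
  have h2 := ratSize_mul_le (F.maxMonos : ℚ) ((F.maxValue : ℚ) ^ F.maxDegree)
  have h3 := ratSize_natCast_le F.maxMonos
  have h4 := ratSize_pow_le F.maxValue F.maxDegree
  have h5 : F.maxDegree * ratSize F.maxValue ≤ F.size * F.size + F.size := by
    rw [← Nat.mul_succ]
    exact Nat.mul_le_mul hd F.ratSize_maxValue_le
  rw [ratSize_one] at h1
  unfold bound
  push_cast
  omega

theorem coeffLE_linRel {b : ℕ} (hb : 2 ≤ b) (hF : F.size ≤ b) (k : F.LinIdx) :
    (F.linRel k).CoeffLE b := by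
  have h0 : (1 : ℕ) ≤ b := by omega
  have hU : ∀ j, ratSize (F.U j) ≤ b := fun j => by
    have := F.ratSize_U_add_ratSize_L_le j
    omega
  have hL : ∀ j, ratSize (F.L j) ≤ b := fun j => by
    have := F.ratSize_U_add_ratSize_L_le j
    omega
  have hc : ∀ k, ratSize (Rat.toNNRat (F.mono k).coeff) ≤ b := fun k =>
    (ratSize_toNNRat_le _).trans ((F.ratSize_coeff_le k).trans hF)
  have hc' : ∀ k, ratSize (Rat.toNNRat (-(F.mono k).coeff)) ≤ b := fun k => by
    have h : ratSize (-(F.mono k).coeff) = ratSize (F.mono k).coeff := by simp [ratSize]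
    exact (ratSize_toNNRat_le _).trans (h.trans_le ((F.ratSize_coeff_le k).trans hF))
  cases k <;> simp [linRel, LinRel.CoeffLE, ratSize_zero, ratSize_one, h0, hb, hU, hL, hc, hc']

theorem market_size_le : F.market.size ≤
    2 * (100 * F.size ^ 2 + 200 * F.size + 400) +
      4 * (100 * F.size ^ 2 + 200 * F.size + 400) ^ 3 := by
  set b := 2 * (F.size * F.size) + 4 * F.size + 11 with hb
  -- `A` bounds the numbers of goods and agents as well as the sizes of all coefficients.
  set A := 100 * F.size ^ 2 + 200 * F.size + 400 with hA
  have hsize := F.market.size_le (b := 29 * b) fun i =>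
    F.relSystem.bundleLE_trader (by omega) F.ratSize_bound_le
      (F.coeffLE_linRel (by omega) (by omega)) i
  have hV := F.card_priceVar_le
  have hK := F.card_linIdx_le
  have hQ := F.card_prodIdx_le
  have hG : Fintype.card F.Good ≤ A := by
    have := card_marketGood_le (V := F.PriceVar) (K := F.LinIdx) (Q := F.ProdIdx)
    rw [hA, pow_two]
    exact this.trans (by omega)
  have hI : Fintype.card F.Agent ≤ A := by
    have := card_marketAgent (K := F.LinIdx) (Q := F.ProdIdx)
    rw [hA, pow_two]
    exact this.trans_le (by omega)
  have hbA : 29 * b ≤ A := by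
    rw [hA, pow_two]
    omega
  calc F.market.size ≤ _ := hsize
    _ ≤ A + A + A * (2 * (A * (A + A))) := by gcongr
    _ = 2 * A + 4 * A ^ 3 := by ring

end PolySystem

end LeontiefReduction

theorem mainTheorem1 :
    (∀ F : LeontiefReduction.PolySystem,
      (∀ p : F.Good → ℝ, F.market.IsEquilibrium p →
        0 < p F.specialGood ∧ F.market.IsEquilibrium ((p F.specialGood)⁻¹ • p)) ∧
      (fun (p : F.Good → ℝ) (j : Fin F.n) => p (F.varGood j)) ''
          {p | F.market.IsEquilibrium p ∧ p F.specialGood = 1} = F.solutions) ∧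
    ∃ P : Polynomial ℕ, ∀ F : LeontiefReduction.PolySystem,
      F.market.size ≤ P.eval F.size := by
  refine ⟨fun F => ⟨fun p hp => ?_, F.image_isEquilibrium_eq_solutions⟩, ?_⟩
  · have hs : 0 < p F.specialGood := (F.relSystem.holds_of_isEquilibrium F.bound hp).1
    exact ⟨hs, hp.smul (inv_pos.2 hs)⟩
  · let A : Polynomial ℕ := 100 * Polynomial.X ^ 2 + 200 * Polynomial.X + 400
    refine ⟨2 * A + 4 * A ^ 3, fun F => F.market_size_le.trans_eq ?_⟩
    simp [A]
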